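/- Work over $\mathbb C$. A conformal algebra is a $\mathbb C[\partial]$-module $C$ with $\mathbb C$-bilinear products $(a,b)\mapsto a_{(n)}b$, $n\ge 0$, such that for all $a,b\in C$: $a_{(n)}b=0$ for all large $n$; $\partial(a_{(n)}b)=(\partial a)_{(n)}b+a_{(n)}(\partial b)$; and $(\partial a)_{(n)}b=-n\,a_{(n-1)}b$. It is associative if $a_{(m)}(b_{(n)}c)=\sum_{j\ge0}\binom mj (a_{(j)}b)_{(m+n-j)}c$ for all $m,n\ge 0$. The degree of locality $N(a,b)$ is the least $N\ge 0$ with $a_{(n)}b=0$ for all $n\ge N$. A conformal identity is an element $e$ with $e_{(0)}f=f$ for all $f\in C$ and $N(e,e)=1$; $C$ is unital if it has one. The left annihilator is $L(C)=\{f\in C: f_{(n)}g=0 \text{ for all } g\in C,\ n\ge 0\}$. The coefficient algebra $\mathrm{Coeff}\,C$ is the quotient of $C[t,t^{-1}]$, with product $(at^l)(bt^m)=\sum_{j\ge0}\binom lj (a_{(j)}b)\,t^{l+m-j}$, by the ideal $(\partial+\partial/\partial t)\,C[t,t^{-1}]$. For a finite $S\subset C$ let $C_r(S)$ be the $\mathbb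 C[\partial]$-span of all products of at most $r$ elements of $S$, with any bracketing and any orders of multiplication, and put $\operatorname{GKdim} C=\sup_S\limsup_{r\to\infty}\frac{\log \operatorname{rk}_{\mathbb C[\partial]} C_r(S)}{\log r}$, the supremum being over all finite $S\subset C$. For an algebra $A$ over $\mathbb C$ put $\operatorname{GKdim} A=\sup_V\limsup_{r\to\infty}\frac{\log\dim(V^1+\dots+V^r)}{\log r}$ over all finite-dimensional subspaces $V\subset A$. (Here $\log 0$ is read as $0$.) For a locally nilpotent derivation $\delta$ of a unital associative algebra $A$, the localized Ore extension $A[t,t^{-1};\delta]$ is the free left $A$-module on $\{t^n\}_{n\in\mathbb Z}$ with product $(at^l)(bt^m)=\sum_{j\ge 0}(-1)^j\binom lj a\,\delta^j(b)\,t^{l+m-j}$; in particular $tb=bt-\delta(b)$. **Proposition 3.5.** Let $C$ be a unital associative conformal algebra with $L(C)=0$. Then $\operatorname{GKdim}\mathrm{Coeff}\,C=\operatorname{GKdim} C+1$, and there are a unital associative $\mathbb C$-algebra $A$ and a locally nilpotent derivation $\delta$ of $A$ such that $\mathrm{Coeff}\,C\cong A[t,t^{-1};\delta]$ as $\mathbb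 C$-algebras, $\operatorname{GKdim} A=\operatorname{GKdim} C$, and, if $C$ is finitely generated as a conformal algebra, then $A$ is finitely generated as an algebra. -/

import Mathlib

open Polynomial

universe u

set_option linter.unusedSectionVars false

noncomputable section

section Laurent

variable {M : Type u} [AddCommGroup M] [Module ℂ M]

/-- The linear map `(v_j)_j ↦ ∑_j (l choose j) v_j t^(k-j)` into Laurent polynomials `M[t, t⁻¹]`,
which are realised as finitely supported functions `ℤ →₀ M`, with `v t^k` being `single k v`. -/
def laurentExpand (l k : ℤ) : (ℕ →₀ M) →ₗ[ℂ] (ℤ →₀ M) :=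
  Finsupp.lsum ℂ fun j : ℕ => (Ring.choose l j : ℤ) • Finsupp.lsingle (k - j)

/-- The bilinear product on `M[t, t⁻¹]` given by
`(a t^l) (b t^m) = ∑_j (l choose j) B(a, b)_j t^(l+m-j)`. -/
def laurentMul (B : M →ₗ[ℂ] M →ₗ[ℂ] (ℕ →₀ M)) :
    (ℤ →₀ M) →ₗ[ℂ] (ℤ →₀ M) →ₗ[ℂ] (ℤ →₀ M) :=
  Finsupp.lsum ℂ fun l : ℤ =>
    (Finsupp.lsum ℂ fun m : ℤ => (B.compr₂ (laurentExpand l (l + m))).flip).flip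

theorem laurentExpand_eq_sum (l k : ℤ) (v : ℕ →₀ M) (N : ℕ) (hN : ∀ j, N ≤ j → v j = 0) :
    laurentExpand l k v =
      ∑ j ∈ Finset.range N, (Ring.choose l j : ℤ) • Finsupp.single (k - j) (v j) := by
  rw [laurentExpand, Finsupp.lsum_apply, Finsupp.sum_of_support_subset v (s := Finset.range N)]
  · simp
  · intro j hj
    by_contra h
    exact (Finsupp.mem_support_iff.mp hj) (hN j (by simpa using h))
  · simp

theorem laurentMul_single_single (B : M →ₗ[ℂ] M →ₗ[ℂ] (ℕ →₀ M)) (l m : ℤ) (a b : M) :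
    laurentMul B (Finsupp.single l a) (Finsupp.single m b) =
      laurentExpand l (l + m) (B a b) := by
  simp [laurentMul]

theorem exists_bound {V : Type u} [Zero V] (v : ℕ →₀ V) : ∃ N, ∀ j, N ≤ j → v j = 0 := by
  refine ⟨v.support.sup id + 1, fun j hj => ?_⟩
  by_contra h
  have := Finset.le_sup (f := id) (Finsupp.mem_support_iff.mpr h)
  simp only [id] at this
  omega

theorem sum_range_range_eq_diag {G : Type*} [AddCommMonoid G] (N D : ℕ) (f : ℕ → ℕ → G)
    (h : ∀ p q, (N ≤ p ∨ N ≤ q) → f p q = 0) (hD : 2 * N ≤ D) :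
    ∑ p ∈ Finset.range N, ∑ q ∈ Finset.range N, f p q =
      ∑ d ∈ Finset.range D, ∑ p ∈ Finset.range (d + 1), f p (d - p) := by
  rw [Finset.sum_range_diag_flip]
  have hsub : Finset.range N ⊆ Finset.range D := by
    intro x; simp only [Finset.mem_range]; omega
  rw [← Finset.sum_subset hsub]
  · refine Finset.sum_congr rfl fun p hp => ?_
    have hp' := Finset.mem_range.mp hp
    refine Finset.sum_subset ?_ ?_
    · intro x; simp only [Finset.mem_range]; omega
    · intro q _ hq
      exact h _ _ (Or.inr (by simpa using hq))
  · intro p _ hp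
    exact Finset.sum_eq_zero fun q _ => h _ _ (Or.inl (by simpa using hp))

theorem laurentMul_single_assoc (B : M →ₗ[ℂ] M →ₗ[ℂ] (ℕ →₀ M))
    (hB : ∀ (m n : ℕ) (a b c : M), B a (B b c n) m =
      ∑ j ∈ Finset.range (m + 1), (m.choose j : ℂ) • B (B a b j) c (m + n - j))
    (l m n : ℤ) (a b c : M) :
    laurentMul B (laurentMul B (Finsupp.single l a) (Finsupp.single m b)) (Finsupp.single n c) =
      laurentMul B (Finsupp.single l a)
        (laurentMul B (Finsupp.single m b) (Finsupp.single n c)) := by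
  obtain ⟨J, hJ⟩ := exists_bound (B a b)
  obtain ⟨Q, hQ⟩ := exists_bound (B b c)
  choose K hK using fun j => exists_bound (B (B a b j) c)
  choose P hP using fun q => exists_bound (B a (B b c q))
  set N := J + Q + (Finset.range J).sup K + (Finset.range Q).sup P with hN
  have h1 : ∀ j k, (N ≤ j ∨ N ≤ k) → B (B a b j) c k = 0 := by
    intro j k hjk
    by_cases hj : J ≤ j
    · simp [hJ j hj]
    · have := Finset.le_sup (f := K) (Finset.mem_range.mpr (not_le.mp hj))
      exact hK j k (by omega)
  have h2 : ∀ p q, (N ≤ p ∨ N ≤ q) → B a (B b c q) p = 0 := by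
    intro p q hpq
    by_cases hq : Q ≤ q
    · simp [hQ q hq]
    · have := Finset.le_sup (f := P) (Finset.mem_range.mpr (not_le.mp hq))
      exact hP q p (by omega)
  have e1 : laurentMul B (laurentMul B (Finsupp.single l a) (Finsupp.single m b))
      (Finsupp.single n c) = ∑ j ∈ Finset.range N, ∑ k ∈ Finset.range N,
        (Ring.choose l j * Ring.choose (l + m - j) k : ℤ) •
          Finsupp.single (l + m + n - (j + k : ℕ)) (B (B a b j) c k) := by
    rw [laurentMul_single_single, laurentExpand_eq_sum _ _ _ N (fun j hj => hJ j (by omega)),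
      map_sum, LinearMap.sum_apply]
    refine Finset.sum_congr rfl fun j hj => ?_
    rw [map_zsmul, LinearMap.smul_apply, laurentMul_single_single,
      laurentExpand_eq_sum _ _ _ N (fun k hk => h1 j k (Or.inr hk)), Finset.smul_sum]
    refine Finset.sum_congr rfl fun k hk => ?_
    rw [smul_smul]
    congr 2
    push_cast; ring
  have e2 : laurentMul B (Finsupp.single l a)
      (laurentMul B (Finsupp.single m b) (Finsupp.single n c)) =
        ∑ p ∈ Finset.range N, ∑ q ∈ Finset.range N,
        (Ring.choose m q * Ring.choose l p : ℤ) •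
          Finsupp.single (l + m + n - (p + q : ℕ)) (B a (B b c q) p) := by
    rw [laurentMul_single_single, laurentExpand_eq_sum _ _ _ N (fun j hj => hQ j (by omega)),
      map_sum, Finset.sum_comm]
    refine Finset.sum_congr rfl fun j hj => ?_
    rw [map_zsmul, laurentMul_single_single,
      laurentExpand_eq_sum _ _ _ N (fun k hk => h2 k j (Or.inl hk)), Finset.smul_sum]
    refine Finset.sum_congr rfl fun k hk => ?_
    rw [smul_smul]
    congr 2
    push_cast; ring
  rw [e1, e2, sum_range_range_eq_diag N (2 * N) _ (fun j k h => by rw [h1 j k h]; simp) le_rfl,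
    sum_range_range_eq_diag N (2 * N) _ (fun p q h => by rw [h2 p q h]; simp) le_rfl]
  refine Finset.sum_congr rfl fun d _ => ?_
  let f : ℕ → ℕ → (ℤ →₀ M) := fun j i => (Ring.choose l j *
        (Ring.choose (l - j) i * Ring.choose m (d - j - i)) : ℤ) •
        Finsupp.single (l + m + n - (d : ℕ)) (B (B a b j) c (d - j))
  have e3 : ∀ p ∈ Finset.range (d + 1),
      (Ring.choose m (d - p) * Ring.choose l p : ℤ) •
        Finsupp.single (l + m + n - (p + (d - p) : ℕ)) (B a (B b c (d - p)) p) =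
      ∑ j ∈ Finset.range (p + 1), f j (p - j) := by
    intro p hp
    have hp' : p ≤ d := by simpa [Nat.lt_succ_iff] using hp
    rw [hB, ← Finsupp.lsingle_apply (R := ℂ), map_sum, Finset.smul_sum]
    refine Finset.sum_congr rfl fun j hj => ?_
    have hj' : j ≤ p := by simpa [Nat.lt_succ_iff] using hj
    have h3 := Ring.choose_smul_choose l hj'
    have h4 : d - j - (p - j) = d - p := by omega
    simp only [f]
    rw [Nat.add_sub_cancel' hp', Nat.cast_smul_eq_nsmul, ← natCast_zsmul, map_zsmul, smul_smul,
      Finsupp.lsingle_apply, h4, ← mul_assoc (Ring.choose l j), ← h3, nsmul_eq_mul]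
    congr 1
    ring
  rw [Finset.sum_congr rfl e3, Finset.sum_range_diag_flip (d + 1) f]
  simp only [f]
  refine Finset.sum_congr rfl fun j hj => ?_
  have hj' : j ≤ d := by simpa [Nat.lt_succ_iff] using hj
  rw [← Finset.sum_smul, ← Finset.mul_sum, Nat.add_sub_cancel' hj']
  congr 2
  have h5 : l + m - j = (l - j) + m := by ring
  rw [h5, Ring.add_choose_eq _ (Commute.all _ _),
    Finset.Nat.sum_antidiagonal_eq_sum_range_succ_mk]
  congr 2
  omega

/-- If `B(a, b)_n` satisfies the associativity law of conformal algebras, then the product on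
`M[t, t⁻¹]` is associative. -/
theorem laurentMul_assoc (B : M →ₗ[ℂ] M →ₗ[ℂ] (ℕ →₀ M))
    (hB : ∀ (m n : ℕ) (a b c : M), B a (B b c n) m =
      ∑ j ∈ Finset.range (m + 1), (m.choose j : ℂ) • B (B a b j) c (m + n - j))
    (x y z : ℤ →₀ M) :
    laurentMul B (laurentMul B x y) z = laurentMul B x (laurentMul B y z) := by
  induction x using Finsupp.induction_linear with
  | zero => simp
  | add x₁ x₂ h₁ h₂ => simp only [map_add, LinearMap.add_apply, h₁, h₂]
  | single l a =>
    induction y using Finsupp.induction_linear with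
    | zero => simp
    | add y₁ y₂ h₁ h₂ => simp only [map_add, LinearMap.add_apply, h₁, h₂]
    | single m b =>
      induction z using Finsupp.induction_linear with
      | zero => simp
      | add z₁ z₂ h₁ h₂ => simp only [map_add, h₁, h₂]
      | single n c => exact laurentMul_single_assoc B hB l m n a b c

end Laurent

section OreExtension

variable {A : Type u} [Ring A] [Algebra ℂ A]

/-- A locally nilpotent `ℂ`-linear derivation of a (not necessarily commutative) algebra. -/
structure LocNilpDerivation (A : Type u) [Ring A] [Algebra ℂ A] where
  toLin : A →ₗ[ℂ] A
  leibniz : ∀ a b, toLin (a * b) = toLin a * b + a * toLin b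
  locNilp : ∀ a, ∃ n : ℕ, (toLin ^ n) a = 0

namespace LocNilpDerivation

variable (δ : LocNilpDerivation A)

theorem exists_pow_bound (a : A) : ∃ N : ℕ, ∀ j, N ≤ j → (δ.toLin ^ j) a = 0 := by
  obtain ⟨N, hN⟩ := δ.locNilp a
  refine ⟨N, fun j hj => ?_⟩
  obtain ⟨i, rfl⟩ := Nat.exists_eq_add_of_le' hj
  rw [pow_add, Module.End.mul_apply, hN, map_zero]

theorem pow_leibniz (n : ℕ) (a b : A) : (δ.toLin ^ n) (a * b) =
    ∑ j ∈ Finset.range (n + 1), n.choose j • ((δ.toLin ^ j) a * (δ.toLin ^ (n - j)) b) := by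
  rw [← Finset.Nat.sum_antidiagonal_eq_sum_range_succ_mk
    (fun x : ℕ × ℕ => n.choose x.1 • ((δ.toLin ^ x.1) a * (δ.toLin ^ x.2) b))]
  induction n with
  | zero => simp
  | succ n ih =>
    rw [Finset.sum_antidiagonal_choose_succ_nsmul
      (fun i j => (δ.toLin ^ i) a * (δ.toLin ^ j) b), pow_succ', Module.End.mul_apply, ih,
      map_sum, ← Finset.sum_add_distrib]
    refine Finset.sum_congr rfl fun x hx => ?_
    rw [map_nsmul, δ.leibniz, smul_add, pow_succ' _ x.1, pow_succ' _ x.2, Module.End.mul_apply,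
      Module.End.mul_apply, Nat.choose_symm_of_eq_add (Finset.HasAntidiagonal.mem_antidiagonal.mp hx).symm,
      add_comm]

/-- The sequence `((-1)^j a δ^j(b))_j`. -/
def seq : A →ₗ[ℂ] A →ₗ[ℂ] (ℕ →₀ A) :=
  LinearMap.mk₂ ℂ
    (fun a b => Finsupp.ofSupportFinite (fun j : ℕ => (-1 : ℂ) ^ j • (a * (δ.toLin ^ j) b)) (by
      obtain ⟨N, hN⟩ := δ.exists_pow_bound b
      refine (Set.finite_lt_nat N).subset fun j hj => ?_
      by_contra h
      exact hj (by simp [hN j (not_lt.mp h)])))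
    (fun a a' b => by ext j; simp [Finsupp.ofSupportFinite_coe, add_mul])
    (fun c a b => by ext j; simp [Finsupp.ofSupportFinite_coe, smul_comm c])
    (fun a b b' => by ext j; simp [Finsupp.ofSupportFinite_coe, mul_add])
    (fun c a b => by ext j; simp [Finsupp.ofSupportFinite_coe, smul_comm c])

theorem seq_apply (a b : A) (j : ℕ) :
    δ.seq a b j = (-1 : ℂ) ^ j • (a * (δ.toLin ^ j) b) := rfl

theorem seq_assoc (m n : ℕ) (a b c : A) : δ.seq a (δ.seq b c n) m =
    ∑ j ∈ Finset.range (m + 1), (m.choose j : ℂ) • δ.seq (δ.seq a b j) c (m + n - j) := by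
  rw [seq_apply, seq_apply, map_smul, pow_leibniz, Finset.smul_sum, Finset.mul_sum,
    Finset.smul_sum]
  refine Finset.sum_congr rfl fun j hj => ?_
  have hj' : j ≤ m := by simpa [Nat.lt_succ_iff] using hj
  obtain ⟨i, rfl⟩ := Nat.exists_eq_add_of_le hj'
  have h1 : j + i - j + n = i + n := by omega
  have h2 : j + i + n - j = i + n := by omega
  rw [seq_apply, seq_apply, h2, ← Module.End.mul_apply, ← pow_add, h1, ← Nat.cast_smul_eq_nsmul ℂ]
  simp only [mul_smul_comm, smul_mul_assoc, smul_smul, mul_assoc]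
  congr 1
  ring

end LocNilpDerivation

/-- The localized Ore extension `A[t, t⁻¹; δ]`: the free left `A`-module on the powers of `t`, with
the multiplication determined by `t b = b t - δ(b)`, that is,
`t^l b = ∑_j (-1)^j (l choose j) δ^j(b) t^(l-j)` for every integer `l`.  The element `a t^l` is
`Finsupp.single l a`. -/
def OreLaurent (_δ : LocNilpDerivation A) : Type u := ℤ →₀ A

namespace OreLaurent

variable (δ : LocNilpDerivation A)

instance : AddCommGroup (OreLaurent δ) := inferInstanceAs (AddCommGroup (ℤ →₀ A))

instance : Module ℂ (OreLaurent δ) := inferInstanceAs (Module ℂ (ℤ →₀ A))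

/-- The product `(a t^l) (b t^m) = ∑_j (-1)^j (l choose j) a δ^j(b) t^(l+m-j)`. -/
instance : Mul (OreLaurent δ) := ⟨fun x y => laurentMul δ.seq x y⟩

instance : One (OreLaurent δ) := ⟨Finsupp.single (0 : ℤ) (1 : A)⟩

theorem mul_def (x y : OreLaurent δ) : x * y = laurentMul δ.seq x y := rfl

theorem map_one_eq_zero : δ.toLin 1 = 0 := by
  have h := δ.leibniz 1 1
  simpa using h

instance : Ring (OreLaurent δ) :=
  { (inferInstance : AddCommGroup (OreLaurent δ)), (inferInstance : Mul (OreLaurent δ)),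
    (inferInstance : One (OreLaurent δ)) with
    left_distrib := fun x y z => map_add (laurentMul δ.seq x) y z
    right_distrib := fun x y z => LinearMap.map_add₂ (laurentMul δ.seq) x y z
    zero_mul := fun x => LinearMap.map_zero₂ (laurentMul δ.seq) x
    mul_zero := fun x => map_zero (laurentMul δ.seq x)
    mul_assoc := fun x y z => laurentMul_assoc δ.seq δ.seq_assoc x y z
    one_mul := fun x => by
      change laurentMul δ.seq (Finsupp.single 0 1) x = x
      induction x using Finsupp.induction_linear with
      | zero => simp
      | add x y hx hy => rw [map_add, hx, hy]
      | single m b =>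
        obtain ⟨N, hN⟩ := exists_bound (δ.seq 1 b)
        rw [laurentMul_single_single, laurentExpand_eq_sum _ _ _ (N + 1)
          (fun j hj => hN j (by omega)), Finset.sum_range_succ']
        simp [Ring.choose_zero_succ, LocNilpDerivation.seq_apply]
    mul_one := fun x => by
      change laurentMul δ.seq x (Finsupp.single 0 1) = x
      induction x using Finsupp.induction_linear with
      | zero => simp
      | add x y hx hy => rw [LinearMap.map_add₂, hx, hy]
      | single m b =>
        rw [laurentMul_single_single, laurentExpand_eq_sum _ _ _ 1 (fun j hj => by
          obtain ⟨i, rfl⟩ := Nat.exists_eq_add_of_le' hj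
          simp [LocNilpDerivation.seq_apply, pow_succ, map_one_eq_zero])]
        simp [LocNilpDerivation.seq_apply] }

end OreLaurent

end OreExtension

section Conformal

/-- A conformal algebra: a `ℂ[∂]`-module (`∂` acts as `X`) with bilinear products
`a ₍ₙ₎ b = nprod n a b`, `n ≥ 0`, subject to locality, the Leibniz rule and
`(∂a) ₍ₙ₎ b = -n a ₍ₙ₋₁₎ b`. -/
class ConformalAlgebra (C : Type u) [AddCommGroup C] [Module ℂ C] [Module ℂ[X] C]
    [IsScalarTower ℂ ℂ[X] C] where
  nprod : ℕ → C →ₗ[ℂ] C →ₗ[ℂ] C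
  locality : ∀ a b : C, ∃ N : ℕ, ∀ n, N ≤ n → nprod n a b = 0
  leibniz : ∀ (n : ℕ) (a b : C), (X : ℂ[X]) • nprod n a b =
    nprod n ((X : ℂ[X]) • a) b + nprod n a ((X : ℂ[X]) • b)
  sesqui : ∀ (n : ℕ) (a b : C), nprod n ((X : ℂ[X]) • a) b = -(n : ℂ) • nprod (n - 1) a b

namespace ConformalAlgebra

variable {C : Type u} [AddCommGroup C] [Module ℂ C] [Module ℂ[X] C]
    [IsScalarTower ℂ ℂ[X] C] [ConformalAlgebra C]

/-- A conformal algebra is associative if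
`a ₍ₘ₎ (b ₍ₙ₎ c) = ∑_j (m choose j) (a ₍ⱼ₎ b) ₍ₘ₊ₙ₋ⱼ₎ c`. -/
class IsAssociative (C : Type u) [AddCommGroup C] [Module ℂ C] [Module ℂ[X] C]
    [IsScalarTower ℂ ℂ[X] C] [ConformalAlgebra C] : Prop where
  assoc : ∀ (m n : ℕ) (a b c : C), nprod m a (nprod n b c) =
    ∑ j ∈ Finset.range (m + 1), (m.choose j : ℂ) • nprod (m + n - j) (nprod j a b) c

/-- The degree of locality `N(a, b)`: the least `N` with `a ₍ₙ₎ b = 0` for all `n ≥ N`. -/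
def localityDegree (a b : C) : ℕ := sInf {N : ℕ | ∀ n, N ≤ n → nprod n a b = 0}

/-- `e` is a conformal identity if `e ₍₀₎ f = f` for all `f` and `N(e, e) = 1`. -/
def IsConformalIdentity (e : C) : Prop :=
  (∀ f : C, nprod 0 e f = f) ∧ localityDegree e e = 1

/-- The left annihilator `L(C)`. -/
def leftAnnihilator (C : Type u) [AddCommGroup C] [Module ℂ C] [Module ℂ[X] C]
    [IsScalarTower ℂ ℂ[X] C] [ConformalAlgebra C] : Set C :=
  {f | ∀ (g : C) (n : ℕ), nprod n f g = 0}

/-- The sequence of products `(a ₍ₙ₎ b)_n`. -/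
def seq : C →ₗ[ℂ] C →ₗ[ℂ] (ℕ →₀ C) :=
  LinearMap.mk₂ ℂ
    (fun a b => Finsupp.ofSupportFinite (fun n : ℕ => nprod n a b) (by
      obtain ⟨N, hN⟩ := locality a b
      refine (Set.finite_lt_nat N).subset fun j hj => ?_
      by_contra h
      exact hj (hN j (not_lt.mp h))))
    (fun a a' b => by ext j; simp [Finsupp.ofSupportFinite_coe])
    (fun c a b => by ext j; simp [Finsupp.ofSupportFinite_coe])
    (fun a b b' => by ext j; simp [Finsupp.ofSupportFinite_coe])
    (fun c a b => by ext j; simp [Finsupp.ofSupportFinite_coe])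

theorem seq_apply (a b : C) (j : ℕ) : seq a b j = nprod j a b := rfl

/-- The `0`-th product on `C[t, t⁻¹]`:
`(a t^l) ₍₀₎ (b t^m) = ∑_j (l choose j) (a ₍ⱼ₎ b) t^(l+m-j)`. -/
def tildeMul : (ℤ →₀ C) →ₗ[ℂ] (ℤ →₀ C) →ₗ[ℂ] (ℤ →₀ C) := laurentMul seq

variable (C) in
/-- The operator `∂ + ∂/∂t` on `C[t, t⁻¹]`. -/
def tildeDeriv : (ℤ →₀ C) →ₗ[ℂ] (ℤ →₀ C) :=
  Finsupp.lsum ℂ fun n : ℤ =>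
    Finsupp.lsingle n ∘ₗ (LinearMap.lsmul ℂ[X] C X).restrictScalars ℂ +
      n • Finsupp.lsingle (n - 1)

theorem tildeDeriv_single (n : ℤ) (a : C) : tildeDeriv C (Finsupp.single n a) =
    Finsupp.single n ((X : ℂ[X]) • a) + n • Finsupp.single (n - 1) a := by
  simp [tildeDeriv]

theorem expand_deriv (l k : ℤ) (a b : C) :
    laurentExpand l k (seq ((X : ℂ[X]) • a) b) +
      l • laurentExpand (l - 1) (k - 1) (seq a b) = 0 := by
  obtain ⟨N, hN⟩ := exists_bound (seq a b)
  rw [laurentExpand_eq_sum _ _ _ (N + 1), laurentExpand_eq_sum _ _ _ N hN,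
    Finset.sum_range_succ', Finset.smul_sum, add_right_comm, ← Finset.sum_add_distrib]
  · rw [Finset.sum_eq_zero]
    · simp [seq_apply, sesqui]
    · intro j _
      have h := Ring.choose_smul_choose l (Nat.le_add_left 1 j)
      have e : k - ((j + 1 : ℕ) : ℤ) = k - 1 - j := by push_cast; ring
      have e' : -((j + 1 : ℕ) : ℂ) = ((-((j + 1 : ℕ) : ℤ) : ℤ) : ℂ) := by push_cast; ring
      rw [seq_apply, seq_apply, sesqui, Nat.add_sub_cancel, e, e', Int.cast_smul_eq_zsmul,
        ← Finsupp.lsingle_apply (R := ℂ), ← Finsupp.lsingle_apply (R := ℂ), map_zsmul,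
        smul_smul, smul_smul, ← add_smul]
      simp only [Nat.choose_one_right, Ring.choose_one_right, Nat.cast_one, Nat.add_sub_cancel,
        nsmul_eq_mul] at h
      rw [← h]
      convert zero_smul ℤ _ using 2
      ring
  · intro j hj
    obtain ⟨i, rfl⟩ := Nat.exists_eq_add_of_le' hj
    have := hN (i + N) (by omega)
    rw [seq_apply] at this
    rw [seq_apply, sesqui, show i + (N + 1) - 1 = i + N by omega, this, smul_zero]

theorem tildeMul_tildeDeriv_left (x y : ℤ →₀ C) : tildeMul (tildeDeriv C x) y = 0 := by
  induction x using Finsupp.induction_linear with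
  | zero => simp
  | add x₁ x₂ h₁ h₂ => rw [map_add, map_add, LinearMap.add_apply, h₁, h₂, add_zero]
  | single l a =>
    induction y using Finsupp.induction_linear with
    | zero => simp
    | add y₁ y₂ h₁ h₂ => rw [map_add, h₁, h₂, add_zero]
    | single m b =>
      rw [tildeDeriv_single, map_add, map_zsmul, LinearMap.add_apply, LinearMap.smul_apply,
        tildeMul, laurentMul_single_single, laurentMul_single_single,
        show l - 1 + m = l + m - 1 by ring, expand_deriv]

theorem tildeMul_tildeDeriv_right (x y : ℤ →₀ C) :
    tildeMul x (tildeDeriv C y) = tildeDeriv C (tildeMul x y) := by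
  induction x using Finsupp.induction_linear with
  | zero => simp
  | add x₁ x₂ h₁ h₂ => simp only [map_add, LinearMap.add_apply, h₁, h₂]
  | single l a =>
    induction y using Finsupp.induction_linear with
    | zero => simp
    | add y₁ y₂ h₁ h₂ => simp only [map_add, h₁, h₂]
    | single m b =>
      have h0 := expand_deriv l (l + m) a b
      obtain ⟨N, hN⟩ := exists_bound (seq a b)
      obtain ⟨N₁, hN₁⟩ := exists_bound (seq ((X : ℂ[X]) • a) b)
      obtain ⟨N₂, hN₂⟩ := exists_bound (seq a ((X : ℂ[X]) • b))
      rw [tildeDeriv_single, map_add, map_zsmul, tildeMul, laurentMul_single_single,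
        laurentMul_single_single, laurentMul_single_single,
        show l + (m - 1) = l + m - 1 by ring, ← sub_eq_zero, ← neg_eq_zero, ← h0]
      rw [laurentExpand_eq_sum _ _ _ (N + N₁ + N₂) (fun j hj => hN₁ j (by omega)),
        laurentExpand_eq_sum _ _ (seq a ((X : ℂ[X]) • b)) (N + N₁ + N₂)
          (fun j hj => hN₂ j (by omega)),
        laurentExpand_eq_sum _ _ (seq a b) (N + N₁ + N₂) (fun j hj => hN j (by omega)),
        laurentExpand_eq_sum _ _ (seq a b) (N + N₁ + N₂) (fun j hj => hN j (by omega)),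
        laurentExpand_eq_sum _ _ (seq a b) (N + N₁ + N₂) (fun j hj => hN j (by omega)),
        map_sum, Finset.smul_sum, Finset.smul_sum, ← Finset.sum_add_distrib,
        ← Finset.sum_sub_distrib, ← Finset.sum_neg_distrib, ← Finset.sum_add_distrib]
      refine Finset.sum_congr rfl fun j _ => ?_
      have h1 := Ring.choose_smul_choose l (Nat.le_add_left 1 j)
      have h2 := Ring.choose_smul_choose l (Nat.le_add_right j 1)
      simp only [Nat.choose_one_right, Ring.choose_one_right, Nat.cast_one, Nat.add_sub_cancel,
        nsmul_eq_mul, Nat.choose_succ_self_right, Nat.add_sub_cancel_left] at h1 h2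
      rw [map_zsmul, tildeDeriv_single]
      simp only [seq_apply, leibniz, Finsupp.single_add]
      rw [show l + m - 1 - (j : ℤ) = l + m - j - 1 by ring]
      generalize Finsupp.single (l + m - j - 1) (nprod j a b) = u
      have h3 : l * Ring.choose (l - 1) j = Ring.choose l j * (l - j) := by
        rw [← h1, ← h2]
      have h4 : (l + m - j) • u = (l - j) • u + m • u := by
        rw [← add_smul]; congr 1; ring
      rw [smul_smul l, h3, h4]
      simp only [smul_add, smul_smul]
      rw [mul_comm m]
      abel

variable (C) in
/-- The coefficient algebra `Coeff C = (C[t, t⁻¹], ₍₀₎) / (∂ + ∂/∂t) C[t, t⁻¹]`. -/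
def Coeff : Type u := (ℤ →₀ C) ⧸ LinearMap.range (tildeDeriv C)

namespace Coeff

instance : AddCommGroup (Coeff C) :=
  inferInstanceAs (AddCommGroup ((ℤ →₀ C) ⧸ LinearMap.range (tildeDeriv C)))

instance : Module ℂ (Coeff C) :=
  inferInstanceAs (Module ℂ ((ℤ →₀ C) ⧸ LinearMap.range (tildeDeriv C)))

variable (C) in
/-- The projection `φ : C[t, t⁻¹] → Coeff C`. -/
def proj : (ℤ →₀ C) →ₗ[ℂ] Coeff C := (LinearMap.range (tildeDeriv C)).mkQ

theorem proj_surjective : Function.Surjective (proj C) :=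
  Submodule.mkQ_surjective _

/-- The multiplication of `Coeff C`, induced by the `0`-th product of `C[t, t⁻¹]`. -/
def mulLin : Coeff C →ₗ[ℂ] Coeff C →ₗ[ℂ] Coeff C :=
  (Submodule.liftQ (LinearMap.range (tildeDeriv C))
    (Submodule.liftQ (LinearMap.range (tildeDeriv C)) (tildeMul.compr₂ (proj C)) (by
      rintro _ ⟨x, rfl⟩
      refine LinearMap.ext fun y => ?_
      change proj C (tildeMul (tildeDeriv C x) y) = 0
      rw [tildeMul_tildeDeriv_left, map_zero])).flip (by
      rintro _ ⟨y, rfl⟩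
      refine LinearMap.ext fun x => ?_
      obtain ⟨x, rfl⟩ := proj_surjective x
      change proj C (tildeMul x (tildeDeriv C y)) = 0
      rw [tildeMul_tildeDeriv_right]
      exact (Submodule.Quotient.mk_eq_zero _).mpr ⟨_, rfl⟩)).flip

instance : Mul (Coeff C) := ⟨fun x y => mulLin x y⟩

theorem proj_mul_proj (x y : ℤ →₀ C) : proj C x * proj C y = proj C (tildeMul x y) := rfl

instance : NonUnitalNonAssocRing (Coeff C) :=
  { (inferInstance : AddCommGroup (Coeff C)), (inferInstance : Mul (Coeff C)) with
    left_distrib := fun x y z => map_add (mulLin x) y z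
    right_distrib := fun x y z => LinearMap.map_add₂ mulLin x y z
    zero_mul := fun x => LinearMap.map_zero₂ mulLin x
    mul_zero := fun x => map_zero (mulLin x) }

/-- The coefficient algebra of an associative conformal algebra is associative. -/
instance [IsAssociative C] : NonUnitalRing (Coeff C) :=
  { (inferInstance : NonUnitalNonAssocRing (Coeff C)) with
    mul_assoc := fun x y z => by
      obtain ⟨x, rfl⟩ := proj_surjective x
      obtain ⟨y, rfl⟩ := proj_surjective y
      obtain ⟨z, rfl⟩ := proj_surjective z
      simp only [proj_mul_proj]
      exact congrArg (proj C) (laurentMul_assoc seq IsAssociative.assoc x y z) }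

end Coeff

/-- `IsMonomial S k x`: the element `x` is a product of `k` elements of `S`, with any positioning of
brackets and any orders of multiplication. -/
inductive IsMonomial (S : Set C) : ℕ → C → Prop
  | of {a : C} (ha : a ∈ S) : IsMonomial S 1 a
  | prod {p q : ℕ} {a b : C} (n : ℕ) (ha : IsMonomial S p a) (hb : IsMonomial S q b) :
      IsMonomial S (p + q) (nprod n a b)

/-- The `ℂ[∂]`-span `C_r` of the products of at most `r` elements of `S`. -/
def growthSpan (S : Set C) (r : ℕ) : Submodule ℂ[X] C :=
  Submodule.span ℂ[X] {x | ∃ k ≤ r, IsMonomial S k x}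

variable (C) in
/-- The Gelfand-Kirillov dimension of a conformal algebra: the supremum over all finite `S` (that is,
over all finitely generated subalgebras) of `limsup_r log (rk C_r) / log r`. -/
def gkDim : EReal :=
  ⨆ S : Finset C, Filter.limsup (fun r : ℕ =>
    ((Real.log (Module.finrank ℂ[X] (growthSpan (S : Set C) r)) / Real.log r : ℝ) : EReal))
    Filter.atTop

variable (C) in
/-- `C` is generated, as a conformal algebra, by a finite set. -/
def IsFinitelyGenerated : Prop :=
  ∃ S : Finset C, ∀ D : Submodule ℂ[X] C, (S : Set C) ⊆ D →
    (∀ (n : ℕ) (a b : C), a ∈ D → b ∈ D → nprod n a b ∈ D) → D = ⊤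

end ConformalAlgebra

end Conformal

section GK

variable {A : Type u} [NonUnitalNonAssocRing A] [Module ℂ A]

/-- `IsAlgMonomial S k x`: the element `x` is a product of `k` elements of `S`, with any positioning
of brackets. -/
inductive IsAlgMonomial (S : Set A) : ℕ → A → Prop
  | of {a : A} (ha : a ∈ S) : IsAlgMonomial S 1 a
  | mul {p q : ℕ} {a b : A} (ha : IsAlgMonomial S p a) (hb : IsAlgMonomial S q b) :
      IsAlgMonomial S (p + q) (a * b)

/-- The span `V^1 + ⋯ + V^r` of the products of at most `r` elements of `S`, where `V` is the span
of `S`. -/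
def algGrowthSpan (S : Set A) (r : ℕ) : Submodule ℂ A :=
  Submodule.span ℂ {x | ∃ k ≤ r, IsAlgMonomial S k x}

variable (A) in
/-- The Gelfand-Kirillov dimension of an algebra: the supremum over all finite `S` of
`limsup_r log (dim (V^1 + ⋯ + V^r)) / log r`, where `V` is the span of `S`. -/
def algGKDim : EReal :=
  ⨆ S : Finset A, Filter.limsup (fun r : ℕ =>
    ((Real.log (Module.finrank ℂ (algGrowthSpan (S : Set A) r)) / Real.log r : ℝ) : EReal))
    Filter.atTop

end GK

end

/-! A unital $C$ with $L(C)=0$ is a differential algebra in disguise. Let $A$ be the set of $b$ with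
$b_{(n)}e=0$ for all $n\ge1$. Associativity makes $A$ stable under all left multiplications
(`nprod_mem_core`), and $e$ is a right identity on $A$ because $b_{(0)}e$ and $b$ act on $C$ alike
and $L(C)=0$. So $A$ is a unital algebra under the product of order 0. Since
$e_{(1)}e_{(n)}=e_{(n+1)}$ as operators, $\delta=-e_{(1)}$ satisfies $\delta^n=(-1)^ne_{(n)}$; it is
a derivation, and locality makes it locally nilpotent. The Taylor formula
$x=\sum_k\frac{(-1)^k}{k!}\partial^k(x_{(k)}e)$ (`eq_sum_nprod_identity`) then gives $C=\mathbb
C[\partial]\otimes A$ with $a_{(n)}b=(-1)^na\,\delta^n(b)$, which `DiffModel` records.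

In $\mathrm{Coeff}\,C$ every $\partial$ can be traded for $-\partial/\partial t$, so
$A[t,t^{-1};\delta]$ maps onto it. The map is injective because elements of the ideal annihilate
everything from the left, while the Ore extension has a 1.

For dimensions, finite generating sets are enlarged to $\delta$-stable finite sets. Then the
conformal growth is $\mathbb C[\partial]\otimes(V^1+\dots+V^r)$ up to a change of generators, of
rank $\dim(V^1+\dots+V^r)$, so $\operatorname{GKdim}C=\operatorname{GKdim}A$. In the Ore extension a
product of $r$ generators has exponents of size $O(r)$, and conversely $r$ different powers of $t$
are reached in length $2r$; this linear factor adds exactly 1. Finite generation passes to $A$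
through the coordinates of the generators and their $\delta$-images. -/

noncomputable section

/-! ### The core of a unital conformal algebra and the decomposition $C=\mathbb C[\partial]\otimes
A$ -/

section DiffModel

open ConformalAlgebra

/-- A presentation of a conformal algebra as `ℂ[∂] ⊗ A`, with the products
`a ₍ₙ₎ b = (-1)^n a δ^n(b)` for `a, b ∈ A`. -/
structure DiffModel (C : Type u) [AddCommGroup C] [Module ℂ C] [Module ℂ[X] C]
    [IsScalarTower ℂ ℂ[X] C] [ConformalAlgebra C] {A : Type u} [Ring A] [Algebra ℂ A]
    (δ : LocNilpDerivation A) where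
  incl : A →ₗ[ℂ] C
  coord : ℕ → C →ₗ[ℂ] A
  coord_smul : ∀ (p : ℂ[X]) (a : A) (k : ℕ), coord k (p • incl a) = p.coeff k • a
  exists_sum : ∀ x : C, ∃ N : ℕ,
    x = ∑ k ∈ Finset.range N, (X ^ k : ℂ[X]) • incl (coord k x)
  nprod_incl : ∀ (n : ℕ) (a b : A), nprod n (incl a) (incl b) = incl (δ.seq a b n)

variable {C : Type u} [AddCommGroup C] [Module ℂ C] [Module ℂ[X] C]
    [IsScalarTower ℂ ℂ[X] C] [ConformalAlgebra C]

namespace ConformalAlgebra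

/-- For $j>n$ the binomial coefficient vanishes, so the truncated difference `n - j` is harmless. -/
theorem nprod_X_pow_smul (j n : ℕ) (a b : C) : nprod n ((X ^ j : ℂ[X]) • a) b =
    ((-1 : ℂ) ^ j * j.factorial * n.choose j) • nprod (n - j) a b := by
  induction j generalizing n with
  | zero => simp
  | succ j ih =>
    rw [pow_succ', mul_smul, sesqui, ih, smul_smul, Nat.sub_sub, add_comm 1 j]
    cases n with
    | zero => simp
    | succ n =>
      congr 1
      have h := congrArg (Nat.cast (R := ℂ)) (Nat.add_one_mul_choose_eq n j)
      rw [Nat.factorial_succ]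
      push_cast at h ⊢
      linear_combination (-(-1 : ℂ) ^ j * j.factorial) * h

/-- The elements `b` with `b ₍ₙ₎ e = 0` for all `n ≥ 1`. -/
def coreSubmodule (e : C) : Submodule ℂ C where
  carrier := {b | ∀ n, 1 ≤ n → nprod n b e = 0}
  add_mem' {a b} ha hb n hn := by rw [map_add, LinearMap.add_apply, ha n hn, hb n hn, add_zero]
  zero_mem' n _ := by simp
  smul_mem' c a ha n hn := by rw [map_smul, LinearMap.smul_apply, ha n hn, smul_zero]

theorem IsConformalIdentity.mem_core {e : C} (he : IsConformalIdentity e) :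
    e ∈ coreSubmodule e := by
  obtain ⟨N, hN⟩ := locality e e
  -- By locality the set is nonempty, so the infimum is attained; $N(e,e)=1$ then says that $e$ lies
  -- in the core.
  have h := Nat.sInf_mem (s := {N : ℕ | ∀ n, N ≤ n → nprod n e e = 0}) ⟨N, hN⟩
  have h2 : sInf {N : ℕ | ∀ n, N ≤ n → nprod n e e = 0} = 1 := he.2
  rw [h2] at h
  exact h

theorem IsConformalIdentity.ne_zero {e : C} (he : IsConformalIdentity e) : e ≠ 0 := by
  rintro rfl
  have h2 : sInf {N : ℕ | ∀ n, N ≤ n → nprod n (0 : C) 0 = 0} = 1 := he.2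
  have : sInf {N : ℕ | ∀ n, N ≤ n → nprod n (0 : C) 0 = 0} = 0 :=
    Nat.sInf_eq_zero.mpr (Or.inl (by simp))
  omega

variable [IsAssociative C]

/-- Expand $0=a_{(m)}(b_{(n)}e)$ by associativity. The terms $(a_{(j)}b)_{(m+n-j)}e$ with $j<m$
vanish by induction, which leaves $(a_{(m)}b)_{(n)}e=0$. -/
theorem nprod_mem_core {e : C} (m : ℕ) (a : C) {b : C} (hb : b ∈ coreSubmodule e) :
    nprod m a b ∈ coreSubmodule e := by
  induction m using Nat.strong_induction_on with
  | _ m ih =>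
    intro n hn
    have h := IsAssociative.assoc m n a b e
    rw [hb n hn, map_zero, Finset.sum_range_succ, Finset.sum_eq_zero, zero_add] at h
    · simpa using h.symm
    · intro j hj
      have hj' := Finset.mem_range.mp hj
      rw [ih j hj' (m + n - j) (by omega), smul_zero]

theorem nprod_zero_left (n : ℕ) (a b c : C) :
    nprod n (nprod 0 a b) c = nprod 0 a (nprod n b c) := by
  have h := IsAssociative.assoc 0 n a b c
  simpa using h.symm

theorem eq_of_forall_nprod_eq (hL : leftAnnihilator C = {0}) {a b : C}
    (h : ∀ n c, nprod n a c = nprod n b c) : a = b := by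
  have : a - b ∈ leftAnnihilator C := fun g n => by
    rw [map_sub, LinearMap.sub_apply, h, sub_self]
  rw [hL] at this
  exact sub_eq_zero.mp this

/-- In $b_{(n)}c=b_{(n)}(e_{(0)}c)$ only the term $(b_{(0)}e)_{(n)}c$ of the associativity sum
survives, so $b-b_{(0)}e\in L(C)$. -/
theorem nprod_zero_identity {e : C} (he : IsConformalIdentity e)
    (hL : leftAnnihilator C = {0}) {b : C} (hb : b ∈ coreSubmodule e) : nprod 0 b e = b := by
  refine eq_of_forall_nprod_eq hL fun n c => ?_
  have h := IsAssociative.assoc n 0 b e c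
  rw [he.1, Finset.sum_range_succ', Finset.sum_eq_zero] at h
  · simpa using h.symm
  · intro j _
    rw [hb (j + 1) (by omega)]
    simp

/-- Taylor formula. Both sides act alike on every $c$: associativity gives $x_{(n)}c=\sum_k\binom
nk(x_{(k)}e)_{(n-k)}c$, and $\partial^k$ in the left argument produces the same binomials up to
$(-1)^kk!$. -/
theorem eq_sum_nprod_identity {e : C} (he : IsConformalIdentity e)
    (hL : leftAnnihilator C = {0}) (x : C) (N : ℕ) (hN : ∀ n, N ≤ n → nprod n x e = 0) :
    x = ∑ k ∈ Finset.range N,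
      (X ^ k : ℂ[X]) • (((-1 : ℂ) ^ k / k.factorial) • nprod k x e) := by
  refine eq_of_forall_nprod_eq hL fun n c => ?_
  have h := IsAssociative.assoc n 0 x e c
  rw [he.1] at h
  rw [h, map_sum, LinearMap.sum_apply]
  have h1 : ∀ k, nprod n ((X ^ k : ℂ[X]) • (((-1 : ℂ) ^ k / k.factorial) • nprod k x e)) c =
      (n.choose k : ℂ) • nprod (n + 0 - k) (nprod k x e) c := by
    intro k
    rw [nprod_X_pow_smul, map_smul, LinearMap.smul_apply, smul_smul, add_zero]
    congr 1
    have h2 : ((-1 : ℂ) ^ k) * (-1) ^ k = 1 := by rw [← mul_pow]; simp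
    have h3 : (k.factorial : ℂ) ≠ 0 := by exact_mod_cast k.factorial_ne_zero
    field_simp
    linear_combination (n.choose k : ℂ) * h2
  simp only [h1]
  -- The two sums have different ranges and are compared on a common larger one: one is cut off by
  -- `hN`, the other by $\binom nk=0$ for $k>n$.
  have ha : Finset.range (n + 1) ⊆ Finset.range (n + 1 + N) := by
    intro i; simp only [Finset.mem_range]; omega
  have hb : Finset.range N ⊆ Finset.range (n + 1 + N) := by
    intro i; simp only [Finset.mem_range]; omega
  rw [Finset.sum_subset ha, Finset.sum_subset hb]
  · intro k _ hk
    rw [hN k (by simpa using hk)]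
    simp
  · intro k _ hk
    rw [Nat.choose_eq_zero_of_lt (by simp only [Finset.mem_range] at hk; omega)]
    simp

/-- Only $e_{(0)}e=e$ and $e_{(1)}e=0$ enter. Hence $e_{(n)}$ is the $n$-th power of the operator
$e_{(1)}$. -/
theorem nprod_identity_succ {e : C} (he : IsConformalIdentity e) (n : ℕ) (x : C) :
    nprod 1 e (nprod n e x) = nprod (n + 1) e x := by
  have h := IsAssociative.assoc 1 n e e x
  rw [Finset.sum_range_succ, Finset.sum_range_one, he.mem_core 1 le_rfl, he.1] at h
  simpa [add_comm] using h

/-- The space of all `b` with `b ₍ₙ₎ e = 0` for `n ≥ 1`, as an algebra under the `0`-th product. -/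
def Core (e : C) (_ : IsConformalIdentity e) (_ : leftAnnihilator C = {0}) : Type u :=
  coreSubmodule e

namespace Core

variable {e : C} (he : IsConformalIdentity e) (hL : leftAnnihilator C = {0})

instance : AddCommGroup (Core e he hL) := inferInstanceAs (AddCommGroup (coreSubmodule e))

instance : Module ℂ (Core e he hL) := inferInstanceAs (Module ℂ (coreSubmodule e))

/-- The inclusion of the core. -/
def incl : Core e he hL →ₗ[ℂ] C := (coreSubmodule e).subtype

theorem incl_injective : Function.Injective (incl he hL) := Subtype.val_injective

/-- The map into the core given by a linear map with values in it. -/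
def codRestrict (f : C →ₗ[ℂ] C) (hf : ∀ x, f x ∈ coreSubmodule e) : C →ₗ[ℂ] Core e he hL :=
  LinearMap.codRestrict (coreSubmodule e) f hf

theorem incl_codRestrict (f : C →ₗ[ℂ] C) (hf : ∀ x, f x ∈ coreSubmodule e) (x : C) :
    incl he hL (codRestrict he hL f hf x) = f x := rfl

instance : Mul (Core e he hL) := ⟨fun a b => ⟨nprod 0 a.1 b.1, nprod_mem_core 0 _ b.2⟩⟩

instance : One (Core e he hL) := ⟨⟨e, he.mem_core⟩⟩

theorem incl_mul (a b : Core e he hL) :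
    incl he hL (a * b) = nprod 0 (incl he hL a) (incl he hL b) := rfl

theorem incl_one : incl he hL 1 = e := rfl

theorem nprod_incl_identity (n : ℕ) (a : Core e he hL) :
    nprod n (incl he hL a) e = if n = 0 then incl he hL a else 0 := by
  split_ifs with h
  · subst h
    exact nprod_zero_identity he hL a.2
  · exact a.2 n (by omega)

instance : Ring (Core e he hL) :=
  { (inferInstance : AddCommGroup (Core e he hL)), (inferInstance : Mul (Core e he hL)),
    (inferInstance : One (Core e he hL)) with
    left_distrib := fun a b c => incl_injective he hL (by simp only [incl_mul, map_add])
    right_distrib := fun a b c => incl_injective he hL (by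
      simp only [incl_mul, map_add, LinearMap.add_apply])
    zero_mul := fun a => incl_injective he hL (by simp [incl_mul])
    mul_zero := fun a => incl_injective he hL (by simp [incl_mul])
    mul_assoc := fun a b c => incl_injective he hL (by
      simp only [incl_mul, nprod_zero_left])
    one_mul := fun a => incl_injective he hL (by rw [incl_mul, incl_one, he.1])
    mul_one := fun a => incl_injective he hL (by
      rw [incl_mul, incl_one, nprod_incl_identity, if_pos rfl]) }

instance : Algebra ℂ (Core e he hL) :=
  Algebra.ofModule (fun c a b => incl_injective he hL (by simp [incl_mul]))
    (fun c a b => incl_injective he hL (by simp [incl_mul]))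

/-- Write $a=a_{(0)}e$ and reassociate: all products on the core reduce to the product of order 0
and the operators $e_{(n)}$. -/
theorem nprod_incl (n : ℕ) (a b : Core e he hL) : nprod n (incl he hL a) (incl he hL b) =
    nprod 0 (incl he hL a) (nprod n e (incl he hL b)) := by
  conv_lhs => rw [← mul_one a, incl_mul, incl_one, nprod_zero_left]

/-- The derivation `-e ₍₁₎` of the core. -/
def derivLin : Core e he hL →ₗ[ℂ] Core e he hL :=
  LinearMap.restrict (p := coreSubmodule e) (q := coreSubmodule e) (-nprod 1 e)
    (fun _ hb => neg_mem (nprod_mem_core 1 e hb))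

theorem incl_derivLin (a : Core e he hL) :
    incl he hL (derivLin he hL a) = -nprod 1 e (incl he hL a) := rfl

theorem incl_derivLin_pow (n : ℕ) (a : Core e he hL) :
    incl he hL ((derivLin he hL ^ n) a) = (-1 : ℂ) ^ n • nprod n e (incl he hL a) := by
  induction n with
  | zero => simp [he.1]
  | succ n ih =>
    rw [pow_succ', Module.End.mul_apply, incl_derivLin, ih, map_smul, nprod_identity_succ he,
      pow_succ]
    simp

/-- The locally nilpotent derivation `-e ₍₁₎` of the core. -/
def deriv : LocNilpDerivation (Core e he hL) where
  toLin := derivLin he hL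
  leibniz a b := incl_injective he hL (by
    rw [map_add, incl_mul, incl_mul, incl_derivLin, incl_derivLin, incl_derivLin, incl_mul]
    -- This reads $e_{(1)}(a_{(0)}b)=a_{(1)}b+(e_{(1)}a)_{(0)}b$, where $a_{(1)}b=a_{(0)}(e_{(1)}b)$
    -- by `nprod_incl`.
    have h := IsAssociative.assoc 1 0 e (incl he hL a) (incl he hL b)
    rw [Finset.sum_range_succ, Finset.sum_range_one, he.1] at h
    rw [h]
    have h1 := nprod_incl he hL 1 a b
    simp [h1, add_comm])
  locNilp a := by
    obtain ⟨N, hN⟩ := locality e (incl he hL a)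
    exact ⟨N, incl_injective he hL (by rw [incl_derivLin_pow, hN N le_rfl]; simp)⟩

/-- A unital associative conformal algebra with zero left annihilator is `ℂ[∂] ⊗ A`, where `A` is
its core. -/
def diffModel : DiffModel C (deriv he hL) where
  incl := incl he hL
  coord k := codRestrict he hL (((-1 : ℂ) ^ k / k.factorial) • (nprod k).flip e)
    (fun x => Submodule.smul_mem _ _ (nprod_mem_core k x he.mem_core))
  coord_smul p a k := incl_injective he hL (by
    rw [incl_codRestrict, map_smul (incl he hL), LinearMap.smul_apply, LinearMap.flip_apply]
    induction p using Polynomial.induction_on' with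
    | add p q hp hq => rw [add_smul, map_add, LinearMap.add_apply, smul_add, hp, hq, coeff_add,
        add_smul]
    | monomial j c =>
      rw [← C_mul_X_pow_eq_monomial, ← smul_eq_C_mul, smul_assoc, map_smul (nprod k) c, LinearMap.smul_apply,
        nprod_X_pow_smul, nprod_incl_identity, coeff_smul, coeff_X_pow]
      -- Only $k=j$ contributes to $(\partial^ja)_{(k)}e$: for $k<j$ the binomial vanishes, for
      -- $k>j$ one meets $a_{(k-j)}e=0$.
      by_cases h : k = j
      · subst h
        have h2 : ((-1 : ℂ) ^ k) * (-1) ^ k = 1 := by rw [← mul_pow]; simp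
        have h3 : (k.factorial : ℂ) ≠ 0 := by exact_mod_cast k.factorial_ne_zero
        simp only [Nat.sub_self, if_true, smul_smul]
        congr 1
        simp only [Nat.choose_self, Nat.cast_one, smul_eq_mul]
        field_simp
        linear_combination c * h2
      · rcases lt_or_gt_of_ne h with h' | h'
        · simp [Nat.choose_eq_zero_of_lt h', h]
        · simp [show k - j ≠ 0 by omega, h])
  exists_sum x := by
    obtain ⟨N, hN⟩ := locality x e
    exact ⟨N, eq_sum_nprod_identity he hL x N hN⟩
  nprod_incl n a b := by
    rw [nprod_incl, LocNilpDerivation.seq_apply, map_smul, incl_mul]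
    change _ = _ • nprod 0 _ (incl he hL ((derivLin he hL ^ n) b))
    rw [incl_derivLin_pow, map_smul, smul_smul, ← mul_pow]
    simp

instance : Nontrivial (Core e he hL) :=
  ⟨⟨1, 0, fun h => he.ne_zero (by simpa [incl_one] using congrArg (incl he hL) h)⟩⟩

end Core

end ConformalAlgebra

end DiffModel

end

noncomputable section

/-! ### The isomorphism between $\mathrm{Coeff}\,C$ and $A[t,t^{-1};\delta]$ -/

section CoeffIso

open ConformalAlgebra

variable {C : Type u} [AddCommGroup C] [Module ℂ C] [Module ℂ[X] C]
    [IsScalarTower ℂ ℂ[X] C] [ConformalAlgebra C] {A : Type u} [Ring A] [Algebra ℂ A]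
    {δ : LocNilpDerivation A}

theorem mapRange_laurentExpand {M N : Type u} [AddCommGroup M] [Module ℂ M] [AddCommGroup N]
    [Module ℂ N] (f : M →ₗ[ℂ] N) (l k : ℤ) (v : ℕ →₀ M) :
    Finsupp.mapRange.linearMap f (laurentExpand l k v) =
      laurentExpand l k (Finsupp.mapRange.linearMap f v) := by
  obtain ⟨J, hJ⟩ := exists_bound v
  rw [laurentExpand_eq_sum l k v J hJ, laurentExpand_eq_sum l k _ J (fun j hj => by simp [hJ j hj]),
    map_sum]
  refine Finset.sum_congr rfl fun j _ => ?_
  rw [map_zsmul]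
  simp

namespace DiffModel

variable (M : DiffModel C δ)

theorem coord_incl (a : A) : M.coord 0 (M.incl a) = a := by
  have h := M.coord_smul 1 a 0
  simpa using h

theorem incl_injective : Function.Injective M.incl :=
  Function.LeftInverse.injective M.coord_incl

/-- The inclusion `A[t, t⁻¹; δ] → C[t, t⁻¹]`. -/
def laurentIncl : OreLaurent δ →ₗ[ℂ] (ℤ →₀ C) := Finsupp.mapRange.linearMap M.incl

theorem laurentIncl_injective : Function.Injective M.laurentIncl :=
  Finsupp.mapRange_injective M.incl (map_zero _) M.incl_injective

theorem laurentMul_mapRange (x y : ℤ →₀ A) :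
    laurentMul seq (Finsupp.mapRange.linearMap M.incl x) (Finsupp.mapRange.linearMap M.incl y) =
      Finsupp.mapRange.linearMap M.incl (laurentMul δ.seq x y) := by
  induction x using Finsupp.induction_linear with
  | zero => simp
  | add x₁ x₂ h₁ h₂ => simp only [map_add, LinearMap.add_apply, h₁, h₂]
  | single l a =>
    induction y using Finsupp.induction_linear with
    | zero => simp
    | add y₁ y₂ h₁ h₂ => simp only [map_add, h₁, h₂]
    | single m b =>
      rw [laurentMul_single_single, mapRange_laurentExpand, Finsupp.mapRange.linearMap_apply,
        Finsupp.mapRange.linearMap_apply, Finsupp.mapRange_single, Finsupp.mapRange_single,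
        laurentMul_single_single]
      congr 1
      ext n
      exact M.nprod_incl n a b

theorem tildeMul_laurentIncl (x y : OreLaurent δ) :
    tildeMul (M.laurentIncl x) (M.laurentIncl y) = M.laurentIncl (x * y) :=
  M.laurentMul_mapRange x y

/-- The homomorphism from the Ore extension to the coefficient algebra. -/
def toCoeff : OreLaurent δ →ₗ[ℂ] Coeff C := Coeff.proj C ∘ₗ M.laurentIncl

theorem toCoeff_mul (x y : OreLaurent δ) :
    M.toCoeff (x * y) = M.toCoeff x * M.toCoeff y := by
  change Coeff.proj C _ = Coeff.proj C _ * Coeff.proj C _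
  rw [Coeff.proj_mul_proj, tildeMul_laurentIncl]

/-- If the image of $x$ in $C[t,t^{-1}]$ has the form $(\partial+\partial_t)y$, its products with
anything on the right are zero; multiplying by 1 gives $x=0$. -/
theorem toCoeff_injective : Function.Injective M.toCoeff := by
  refine (injective_iff_map_eq_zero _).mpr fun x hx => ?_
  obtain ⟨y, hy⟩ := (Submodule.Quotient.mk_eq_zero (LinearMap.range (tildeDeriv C))).mp hx
  have h := M.tildeMul_laurentIncl x 1
  rw [← hy, tildeMul_tildeDeriv_left, mul_one] at h
  exact M.laurentIncl_injective (by rw [← h, map_zero])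

theorem proj_single_X_smul (n : ℤ) (x : C) :
    Coeff.proj C (Finsupp.single n ((X : ℂ[X]) • x)) =
      -(n • Coeff.proj C (Finsupp.single (n - 1) x)) := by
  have h : Coeff.proj C (tildeDeriv C (Finsupp.single n x)) = 0 :=
    (Submodule.Quotient.mk_eq_zero _).mpr ⟨_, rfl⟩
  rw [tildeDeriv_single, map_add, map_zsmul] at h
  exact eq_neg_of_add_eq_zero_left h

theorem toCoeff_surjective : Function.Surjective M.toCoeff := by
  -- Each factor $\partial$ is removed at the cost of lowering the exponent of $t$ by one, until an
  -- element of $A[t,t^{-1}]$ remains.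
  have h : ∀ (k : ℕ) (n : ℤ) (a : A),
      Coeff.proj C (Finsupp.single n ((X ^ k : ℂ[X]) • M.incl a)) ∈ LinearMap.range M.toCoeff := by
    intro k
    induction k with
    | zero =>
      intro n a
      refine ⟨(Finsupp.single n a : ℤ →₀ A), congrArg (Coeff.proj C) ?_⟩
      rw [pow_zero, one_smul]
      exact Finsupp.mapRange_single (hf := map_zero M.incl)
    | succ k ih =>
      intro n a
      rw [pow_succ', mul_smul, proj_single_X_smul]
      exact neg_mem (zsmul_mem (ih _ _) _)
  rw [← LinearMap.range_eq_top, eq_top_iff]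
  rintro x -
  obtain ⟨x, rfl⟩ := Coeff.proj_surjective x
  induction x using Finsupp.induction_linear with
  | zero => simp
  | add x y hx hy => rw [map_add]; exact add_mem hx hy
  | single n x =>
    obtain ⟨N, hN⟩ := M.exists_sum x
    rw [hN, ← Finsupp.lsingle_apply (R := ℂ), map_sum, map_sum]
    exact sum_mem fun k _ => h k n _

/-- The isomorphism between the coefficient algebra and the Ore extension. -/
def coeffEquiv : Coeff C ≃ₗ[ℂ] OreLaurent δ :=
  (LinearEquiv.ofBijective M.toCoeff ⟨M.toCoeff_injective, M.toCoeff_surjective⟩).symm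

theorem coeffEquiv_toCoeff (x : OreLaurent δ) : M.coeffEquiv (M.toCoeff x) = x :=
  LinearEquiv.symm_apply_apply
    (LinearEquiv.ofBijective M.toCoeff ⟨M.toCoeff_injective, M.toCoeff_surjective⟩) x

theorem coeffEquiv_mul (x y : Coeff C) :
    M.coeffEquiv (x * y) = M.coeffEquiv x * M.coeffEquiv y := by
  obtain ⟨x, rfl⟩ := M.toCoeff_surjective x
  obtain ⟨y, rfl⟩ := M.toCoeff_surjective y
  rw [← toCoeff_mul, coeffEquiv_toCoeff, coeffEquiv_toCoeff, coeffEquiv_toCoeff]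

/-- The isomorphism between the coefficient algebra and the Ore extension, as a homomorphism of
algebras. -/
def coeffHom : Coeff C →ₙₐ[ℂ] OreLaurent δ where
  toFun := M.coeffEquiv
  map_smul' := map_smul M.coeffEquiv
  map_zero' := map_zero M.coeffEquiv
  map_add' := map_add M.coeffEquiv
  map_mul' := M.coeffEquiv_mul

end DiffModel

end CoeffIso

end

noncomputable section

/-! ### Growth rates of sequences -/

section GrowthRate

open Filter

/-- The growth rate `limsup_r log f(r) / log r`. -/
def growthRate (f : ℕ → ℕ) : EReal :=
  limsup (fun r : ℕ => ((Real.log (f r) / Real.log r : ℝ) : EReal)) atTop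

theorem growthRate_mono {f g : ℕ → ℕ} (h : ∀ r, f r ≤ g r) : growthRate f ≤ growthRate g := by
  refine limsup_le_limsup (Eventually.of_forall fun r => ?_)
  refine EReal.coe_le_coe_iff.mpr (div_le_div_of_nonneg_right ?_ (Real.log_natCast_nonneg r))
  rcases Nat.eq_zero_or_pos (f r) with h0 | h0
  · rw [h0]
    simpa using Real.log_natCast_nonneg (g r)
  · exact Real.log_le_log (by exact_mod_cast h0) (by exact_mod_cast h r)

theorem tendsto_log_natCast : Tendsto (fun r : ℕ => Real.log r) atTop atTop :=
  Real.tendsto_log_atTop.comp tendsto_natCast_atTop_atTop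

theorem tendsto_add_div_log (x K : ℝ) :
    Tendsto (fun r : ℕ => ((x + K / Real.log r : ℝ) : EReal)) atTop (nhds x) := by
  refine (continuous_coe_real_ereal.tendsto x).comp ?_
  simpa using (tendsto_const_nhds (x := x)).add (tendsto_log_natCast.const_div_atTop K)

theorem growthRate_le_add_one {f g : ℕ → ℕ} (c : ℕ) (h : ∀ r, 1 ≤ r → f r ≤ c * r * g r) :
    growthRate f ≤ growthRate g + 1 := by
  have h1 : limsup (fun r : ℕ => ((1 + Real.log c / Real.log r : ℝ) : EReal)) atTop = 1 :=
    (tendsto_add_div_log 1 _).limsup_eq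
  have h2 : growthRate f ≤ limsup ((fun r : ℕ => ((Real.log (g r) / Real.log r : ℝ) : EReal)) +
      fun r : ℕ => ((1 + Real.log c / Real.log r : ℝ) : EReal)) atTop := by
    refine limsup_le_limsup ?_
    filter_upwards [eventually_ge_atTop 2] with r hr
    have hlr : 0 < Real.log r := Real.log_pos (by exact_mod_cast hr)
    rw [Pi.add_apply, ← EReal.coe_add]
    refine EReal.coe_le_coe_iff.mpr ?_
    have e : Real.log (g r) / Real.log r + (1 + Real.log c / Real.log r) =
        (Real.log (g r) + Real.log r + Real.log c) / Real.log r := by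
      field_simp
      ring
    rw [e]
    refine div_le_div_of_nonneg_right ?_ hlr.le
    rcases Nat.eq_zero_or_pos (f r) with h0 | h0
    · rw [h0]
      simpa using add_nonneg (add_nonneg (Real.log_natCast_nonneg (g r)) hlr.le)
        (Real.log_natCast_nonneg c)
    · have h3 := h r (by omega)
      have h4 : 0 < c * r * g r := lt_of_lt_of_le h0 h3
      have hc : c ≠ 0 := by rintro rfl; simp at h4
      have hg : g r ≠ 0 := by intro h; simp [h] at h4
      have h5 : Real.log (f r) ≤ Real.log ((c * r * g r : ℕ) : ℝ) :=
        Real.log_le_log (by exact_mod_cast h0) (by exact_mod_cast h3)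
      push_cast at h5
      rw [Real.log_mul (mul_ne_zero (by exact_mod_cast hc) (by norm_cast; omega))
        (by exact_mod_cast hg), Real.log_mul (by exact_mod_cast hc) (by norm_cast; omega)] at h5
      linarith
  refine h2.trans ((EReal.limsup_add_le ?_ ?_).trans (by rw [h1]; rfl))
  · right; rw [h1]; exact EReal.coe_ne_top 1
  · right; rw [h1]; exact EReal.coe_ne_bot 1

/-- If $x$ exceeds the growth rate of $f$, then eventually $\log r+\log g(r)\le\log f(2r)<x(\log
r+\log2)$. Dividing by $\log r$ bounds the rate of $g$ by $x-1$. Positivity of $g$ is needed for the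
logarithm of the product, given $\log0=0$. -/
theorem growthRate_add_one_le {f g : ℕ → ℕ} (hg : ∀ r, 1 ≤ r → 1 ≤ g r)
    (h : ∀ r, r * g r ≤ f (2 * r)) : growthRate g + 1 ≤ growthRate f := by
  refine EReal.le_of_forall_lt_iff_le.mp fun x hx => ?_
  have h1 : ∀ᶠ r in atTop, ((Real.log (f r) / Real.log r : ℝ) : EReal) < x :=
    eventually_lt_of_limsup_lt hx
  have h2 : Tendsto (fun r : ℕ => 2 * r) atTop atTop :=
    tendsto_id.const_mul_atTop' (by norm_num)
  have h3 : growthRate g ≤ ((x - 1 : ℝ) : EReal) := by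
    rw [← (tendsto_add_div_log (x - 1) (x * Real.log 2)).limsup_eq]
    refine limsup_le_limsup ?_
    filter_upwards [h2.eventually h1, eventually_ge_atTop 2] with r hr hr2
    have hlr : 0 < Real.log r := Real.log_pos (by exact_mod_cast hr2)
    have hl2 : 0 < Real.log 2 := Real.log_pos (by norm_num)
    refine EReal.coe_le_coe_iff.mpr ?_
    have hr := EReal.coe_lt_coe_iff.mp hr
    push_cast at hr
    rw [Real.log_mul (by norm_num) (by norm_cast; omega), div_lt_iff₀ (by linarith)] at hr
    have hg1 := hg r (by omega)
    have h5 : Real.log ((r * g r : ℕ) : ℝ) ≤ Real.log (f (2 * r)) :=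
      Real.log_le_log (by norm_cast; positivity) (by exact_mod_cast h r)
    push_cast at h5
    rw [Real.log_mul (by norm_cast; omega) (by norm_cast; omega)] at h5
    rw [div_le_iff₀ hlr, add_mul, div_mul_cancel₀ _ hlr.ne']
    linarith
  calc growthRate g + 1 ≤ ((x - 1 : ℝ) : EReal) + ((1 : ℝ) : EReal) := add_le_add_left h3 1
    _ = x := by rw [← EReal.coe_add]; simp

end GrowthRate

end

noncomputable section

/-! ### Growth of algebras -/

section AlgGrowth

theorem algGKDim_eq_iSup (A : Type u) [NonUnitalNonAssocRing A] [Module ℂ A] :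
    algGKDim A =
      ⨆ S : Finset A, growthRate fun r => Module.finrank ℂ (algGrowthSpan (S : Set A) r) := rfl

variable {A B : Type u} [NonUnitalNonAssocRing A] [Module ℂ A] [NonUnitalNonAssocRing B]
  [Module ℂ B]

theorem IsAlgMonomial.pos {S : Set A} {k : ℕ} {x : A} (h : IsAlgMonomial S k x) : 1 ≤ k := by
  induction h <;> omega

theorem IsAlgMonomial.mono {S T : Set A} (hST : S ⊆ T) {k : ℕ} {x : A}
    (h : IsAlgMonomial S k x) : IsAlgMonomial T k x := by
  induction h with
  | of ha => exact .of (hST ha)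
  | mul _ _ iha ihb => exact .mul iha ihb

theorem IsAlgMonomial.mem_span {S : Set A} {k r : ℕ} {x : A} (h : IsAlgMonomial S k x)
    (hk : k ≤ r) : x ∈ algGrowthSpan S r :=
  Submodule.subset_span ⟨k, hk, h⟩

theorem finite_isAlgMonomial {S : Set A} (hS : S.Finite) (k : ℕ) :
    {x | IsAlgMonomial S k x}.Finite := by
  induction k using Nat.strong_induction_on with
  | _ k ih =>
    have h : {x | IsAlgMonomial S k x} ⊆ S ∪ ⋃ p ∈ Set.Iio k, ⋃ q ∈ Set.Iio k,
        Set.image2 (· * ·) {x | IsAlgMonomial S p x} {x | IsAlgMonomial S q x} := by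
      intro x hx
      cases hx with
      | of ha => exact Or.inl ha
      | @mul p q a b ha hb =>
        have := ha.pos
        have := hb.pos
        refine Or.inr (Set.mem_biUnion (x := p) (by simp; omega)
          (Set.mem_biUnion (x := q) (by simp; omega) ⟨a, ha, b, hb, rfl⟩))
    refine (hS.union ?_).subset h
    exact (Set.finite_Iio k).biUnion fun p hp => (Set.finite_Iio k).biUnion fun q hq =>
      (ih p hp).image2 _ (ih q hq)

/-- `finrank` is 0 on infinite-dimensional spaces, so every comparison of dimensions needs this. -/
theorem finiteDimensional_algGrowthSpan {S : Set A} (hS : S.Finite) (r : ℕ) :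
    FiniteDimensional ℂ (algGrowthSpan S r) := by
  refine FiniteDimensional.span_of_finite ℂ ?_
  refine ((Set.finite_Iic r).biUnion fun k _ => finite_isAlgMonomial hS k).subset ?_
  rintro x ⟨k, hk, hx⟩
  exact Set.mem_biUnion (x := k) hk hx

theorem algGrowthSpan_mono {S T : Set A} (hST : S ⊆ T) {r s : ℕ} (hrs : r ≤ s) :
    algGrowthSpan S r ≤ algGrowthSpan T s :=
  Submodule.span_mono fun _ ⟨k, hk, hx⟩ => ⟨k, hk.trans hrs, hx.mono hST⟩

theorem finrank_algGrowthSpan_mono {S T : Set A} (hT : T.Finite) (hST : S ⊆ T) (r : ℕ) :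
    Module.finrank ℂ (algGrowthSpan S r) ≤ Module.finrank ℂ (algGrowthSpan T r) := by
  have := finiteDimensional_algGrowthSpan hT r
  exact Submodule.finrank_mono (algGrowthSpan_mono hST le_rfl)

/-- The product of elements of `V^1 + ⋯ + V^r` and `V^1 + ⋯ + V^s` lies in `V^1 + ⋯ + V^(r+s)`. -/
theorem mul_mem_algGrowthSpan [IsScalarTower ℂ A A] [SMulCommClass ℂ A A] {S : Set A} {r s : ℕ}
    {x y : A} (hx : x ∈ algGrowthSpan S r) (hy : y ∈ algGrowthSpan S s) :
    x * y ∈ algGrowthSpan S (r + s) := by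
  induction hx using Submodule.span_induction with
  | zero => simp
  | add x₁ x₂ _ _ h₁ h₂ => rw [add_mul]; exact add_mem h₁ h₂
  | smul c x _ h => rw [smul_mul_assoc]; exact Submodule.smul_mem _ _ h
  | mem x hx =>
    obtain ⟨k, hk, hx⟩ := hx
    induction hy using Submodule.span_induction with
    | zero => simp
    | add x₁ x₂ _ _ h₁ h₂ => rw [mul_add]; exact add_mem h₁ h₂
    | smul c x _ h => rw [mul_smul_comm]; exact Submodule.smul_mem _ _ h
    | mem y hy =>
      obtain ⟨m, hm, hy⟩ := hy
      exact (hx.mul hy).mem_span (add_le_add hk hm)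

theorem IsAlgMonomial.map {S : Set A} {F : Type*} [FunLike F A B] (f : F)
    (hf : ∀ x y, f (x * y) = f x * f y) {k : ℕ} {x : A} (h : IsAlgMonomial S k x) :
    IsAlgMonomial (f '' S) k (f x) := by
  induction h with
  | of ha => exact .of ⟨_, ha, rfl⟩
  | mul _ _ iha ihb => rw [hf]; exact .mul iha ihb

theorem algGKDim_le_of_injective (f : A →ₗ[ℂ] B) (hf : ∀ x y, f (x * y) = f x * f y)
    (hinj : Function.Injective f) : algGKDim A ≤ algGKDim B := by
  classical
  rw [algGKDim_eq_iSup, algGKDim_eq_iSup]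
  refine iSup_le fun S => le_iSup_of_le (S.image f) (growthRate_mono fun r => ?_)
  have := finiteDimensional_algGrowthSpan (S.image f).finite_toSet r
  rw [(Submodule.equivMapOfInjective f hinj _).finrank_eq]
  refine Submodule.finrank_mono ?_
  rw [algGrowthSpan, Submodule.map_span]
  refine Submodule.span_mono ?_
  rintro _ ⟨x, ⟨k, hk, hx⟩, rfl⟩
  exact ⟨k, hk, by simpa using hx.map f hf⟩

theorem algGKDim_eq_of_equiv (f : A ≃ₗ[ℂ] B) (hf : ∀ x y, f (x * y) = f x * f y) :
    algGKDim A = algGKDim B := by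
  refine le_antisymm (algGKDim_le_of_injective f.toLinearMap hf f.injective)
    (algGKDim_le_of_injective f.symm.toLinearMap (fun x y => ?_) f.symm.injective)
  apply f.injective
  simp [hf]

end AlgGrowth

section AssocGrowth

/-- In an associative algebra, it suffices to bound left-normed products. -/
theorem IsAlgMonomial.mem_of_leftNormed {B : Type u} [NonUnitalRing B] [Module ℂ B] {S : Set B}
    (H : ℕ → Submodule ℂ B) (h1 : ∀ s ∈ S, s ∈ H 1)
    (hs : ∀ k, ∀ u ∈ H k, ∀ s ∈ S, u * s ∈ H (k + 1)) {k : ℕ} {x : B}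
    (h : IsAlgMonomial S k x) : x ∈ H k ∧ ∀ p, ∀ u ∈ H p, u * x ∈ H (p + k) := by
  induction h with
  | of ha => exact ⟨h1 _ ha, fun p u hu => hs p u hu _ ha⟩
  | mul _ _ iha ihb =>
    -- Right multiplication by a monomial is carried along in the induction, so that $u(ab)=(ua)b$
    -- can be handled factor by factor.
    refine ⟨ihb.2 _ _ iha.1, fun p u hu => ?_⟩
    rw [← mul_assoc, ← add_assoc]
    exact ihb.2 _ _ (iha.2 p u hu)

end AssocGrowth

/-! ### Growth of the Ore extension:
$\operatorname{GKdim}A[t,t^{-1};\delta]=\operatorname{GKdim}A+1$ -/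

section OreGrowth

variable {A : Type u} [Ring A] [Algebra ℂ A] (δ : LocNilpDerivation A)

namespace LocNilpDerivation

/-- A finite set can be enlarged to a `δ`-stable finite set, on which a power of `δ` vanishes. -/
theorem exists_stable (S : Finset A) : ∃ T : Finset A, S ⊆ T ∧ (0 : A) ∈ T ∧
    (∀ a ∈ T, δ.toLin a ∈ T) ∧ ∃ p : ℕ, ∀ a ∈ T, ∀ j, p ≤ j → (δ.toLin ^ j) a = 0 := by
  classical
  choose N hN using δ.exists_pow_bound
  set p := S.sup N with hp
  have hp' : ∀ a ∈ S, ∀ j, p ≤ j → (δ.toLin ^ j) a = 0 := fun a ha j hj =>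
    hN a j ((Finset.le_sup ha).trans hj)
  -- The set consists of all $\delta^ja$ with $a\in S$; 0 is added because $\delta^ja=0$ from $j=p$
  -- on.
  refine ⟨S ∪ insert 0 ((Finset.range p ×ˢ S).image fun x => (δ.toLin ^ x.1) x.2),
    Finset.subset_union_left, by simp, ?_, p, ?_⟩
  · have key : ∀ a ∈ S, ∀ j, (δ.toLin ^ j) a ∈
        S ∪ insert 0 ((Finset.range p ×ˢ S).image fun x => (δ.toLin ^ x.1) x.2) := by
      intro a ha j
      rcases lt_or_ge j p with h | h
      · refine Finset.mem_union_right _ (Finset.mem_insert_of_mem ?_)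
        exact Finset.mem_image.mpr ⟨(j, a), by simp [h, ha], rfl⟩
      · rw [hp' a ha j h]; simp
    intro a ha
    rcases Finset.mem_union.mp ha with h | h
    · simpa using key a h 1
    · rcases Finset.mem_insert.mp h with rfl | h
      · simp
      · obtain ⟨⟨j, b⟩, hb, rfl⟩ := Finset.mem_image.mp h
        have := key b (Finset.mem_product.mp hb).2 (j + 1)
        rwa [pow_succ', Module.End.mul_apply] at this
  · intro a ha j hj
    rcases Finset.mem_union.mp ha with h | h
    · exact hp' a h j hj
    · rcases Finset.mem_insert.mp h with rfl | h
      · simp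
      · obtain ⟨⟨i, b⟩, hb, rfl⟩ := Finset.mem_image.mp h
        rw [← Module.End.mul_apply, ← pow_add]
        exact hp' b (Finset.mem_product.mp hb).2 _ (by omega)

variable {δ}

theorem pow_mem_of_stable {T : Set A} (hT : ∀ a ∈ T, δ.toLin a ∈ T) (j : ℕ) {a : A}
    (ha : a ∈ T) : (δ.toLin ^ j) a ∈ T := by
  induction j with
  | zero => simpa
  | succ j ih => rw [pow_succ', Module.End.mul_apply]; exact hT _ ih

/-- By the Leibniz rule, $\delta$ turns a monomial in a $\delta$-stable set into a sum of monomials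
of the same length, so it does not raise the filtration degree. -/
theorem map_mem_algGrowthSpan {T : Set A} (hT : ∀ a ∈ T, δ.toLin a ∈ T) {r : ℕ} {a : A}
    (ha : a ∈ algGrowthSpan T r) : δ.toLin a ∈ algGrowthSpan T r := by
  have key : ∀ {k : ℕ} {x : A}, IsAlgMonomial T k x → δ.toLin x ∈ algGrowthSpan T k := by
    intro k x hx
    induction hx with
    | of ha => exact (IsAlgMonomial.of (hT _ ha)).mem_span le_rfl
    | mul ha hb iha ihb =>
      rw [δ.leibniz]
      exact add_mem (mul_mem_algGrowthSpan iha (hb.mem_span le_rfl))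
        (mul_mem_algGrowthSpan (ha.mem_span le_rfl) ihb)
  induction ha using Submodule.span_induction with
  | zero => simp
  | add x₁ x₂ _ _ h₁ h₂ => rw [map_add]; exact add_mem h₁ h₂
  | smul c x _ h => rw [map_smul]; exact Submodule.smul_mem _ _ h
  | mem x hx =>
    obtain ⟨k, hk, hx⟩ := hx
    exact algGrowthSpan_mono subset_rfl hk (key hx)

theorem seq_mem_algGrowthSpan {T : Set A} (hT : ∀ a ∈ T, δ.toLin a ∈ T) {r s : ℕ} {a b : A}
    (ha : a ∈ algGrowthSpan T r) (hb : b ∈ algGrowthSpan T s) (n : ℕ) :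
    δ.seq a b n ∈ algGrowthSpan T (r + s) := by
  rw [seq_apply]
  refine Submodule.smul_mem _ _ (mul_mem_algGrowthSpan ha ?_)
  induction n with
  | zero => simpa
  | succ n ih => rw [pow_succ', Module.End.mul_apply]; exact map_mem_algGrowthSpan hT ih

end LocNilpDerivation

namespace OreLaurent

instance : IsScalarTower ℂ (OreLaurent δ) (OreLaurent δ) :=
  ⟨fun c x y => LinearMap.map_smul₂ (laurentMul δ.seq) c x y⟩

instance : SMulCommClass ℂ (OreLaurent δ) (OreLaurent δ) :=
  ⟨fun c x y => (map_smul (laurentMul δ.seq x) c y).symm⟩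

/-- The element `a t^l`. -/
def mono (l : ℤ) : A →ₗ[ℂ] OreLaurent δ := Finsupp.lsingle l

variable {δ}

theorem mono_mul_mono (l m : ℤ) (a b : A) :
    mono δ l a * mono δ m b = laurentExpand l (l + m) (δ.seq a b) :=
  laurentMul_single_single _ _ _ _ _

theorem mono_mul_mono_eq_sum (l m : ℤ) (a b : A) (N : ℕ) (hN : ∀ j, N ≤ j → δ.seq a b j = 0) :
    mono δ l a * mono δ m b =
      ∑ j ∈ Finset.range N, (Ring.choose l j : ℤ) • mono δ (l + m - j) (δ.seq a b j) :=
  (mono_mul_mono l m a b).trans (laurentExpand_eq_sum _ _ _ N hN)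

theorem mono_zero_mul_mono_zero (a b : A) : mono δ 0 a * mono δ 0 b = mono δ 0 (a * b) := by
  obtain ⟨N, hN⟩ := exists_bound (δ.seq a b)
  rw [mono_mul_mono_eq_sum _ _ _ _ (N + 1) (fun j hj => hN j (by omega)), Finset.sum_range_succ',
    Finset.sum_eq_zero]
  · simp [LocNilpDerivation.seq_apply]
  · intro j _
    rw [Ring.choose_zero_succ, zero_smul]

theorem mono_mul_mono_one (l m : ℤ) (a : A) : mono δ l a * mono δ m 1 = mono δ (l + m) a := by
  rw [mono_mul_mono_eq_sum _ _ _ _ 1 (fun j hj => by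
    obtain ⟨i, rfl⟩ := Nat.exists_eq_add_of_le' hj
    simp [LocNilpDerivation.seq_apply, pow_succ, map_one_eq_zero])]
  simp [LocNilpDerivation.seq_apply]

variable (δ) in
/-- Laurent polynomials with coefficients in `W` and exponents in `[-K, K]`. -/
def box (W : Submodule ℂ A) (K : ℕ) : Submodule ℂ (OreLaurent δ) :=
  ⨆ l ∈ Finset.Icc (-(K : ℤ)) K, W.map (mono δ l)

theorem mono_mem_box {W : Submodule ℂ A} {K : ℕ} {l : ℤ} (h1 : -(K : ℤ) ≤ l) (h2 : l ≤ K)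
    {a : A} (ha : a ∈ W) : mono δ l a ∈ box δ W K :=
  Submodule.mem_iSup_of_mem l (Submodule.mem_iSup_of_mem (Finset.mem_Icc.mpr ⟨h1, h2⟩)
    (Submodule.mem_map_of_mem ha))

theorem box_mono {W W' : Submodule ℂ A} (h : W ≤ W') {K K' : ℕ} (hK : K ≤ K') :
    box δ W K ≤ box δ W' K' := by
  refine iSup₂_le fun l hl => ?_
  rintro _ ⟨a, ha, rfl⟩
  rw [Finset.mem_Icc] at hl
  exact mono_mem_box (by omega) (by omega) (h ha)

variable (δ) in
/-- The map from tuples of coefficients to Laurent polynomials with exponents in `[-K, K]`. -/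
def boxMap (W : Submodule ℂ A) (K : ℕ) :
    (Finset.Icc (-(K : ℤ)) K → W) →ₗ[ℂ] OreLaurent δ :=
  ∑ l : Finset.Icc (-(K : ℤ)) K, mono δ l.1 ∘ₗ W.subtype ∘ₗ LinearMap.proj l

theorem box_le_range_boxMap (W : Submodule ℂ A) (K : ℕ) :
    box δ W K ≤ LinearMap.range (boxMap δ W K) := by
  refine iSup₂_le fun l hl => ?_
  rintro _ ⟨a, ha, rfl⟩
  refine ⟨Pi.single ⟨l, hl⟩ ⟨a, ha⟩, ?_⟩
  simp only [boxMap, LinearMap.sum_apply, LinearMap.comp_apply, LinearMap.proj_apply]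
  rw [Finset.sum_eq_single ⟨l, hl⟩]
  · simp
  · intro b _ hb
    rw [Pi.single_eq_of_ne hb, map_zero, map_zero]
  · simp

theorem finiteDimensional_box (W : Submodule ℂ A) [FiniteDimensional ℂ W] (K : ℕ) :
    FiniteDimensional ℂ (box δ W K) :=
  Submodule.finiteDimensional_of_le (box_le_range_boxMap W K)

theorem finrank_box_le (W : Submodule ℂ A) [FiniteDimensional ℂ W] (K : ℕ) :
    Module.finrank ℂ (box δ W K) ≤ (2 * K + 1) * Module.finrank ℂ W := by
  calc Module.finrank ℂ (box δ W K) ≤ Module.finrank ℂ (LinearMap.range (boxMap δ W K)) :=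
        Submodule.finrank_mono (box_le_range_boxMap W K)
    _ ≤ Module.finrank ℂ (Finset.Icc (-(K : ℤ)) K → W) := LinearMap.finrank_range_le _
    _ = (2 * K + 1) * Module.finrank ℂ W := by
        rw [Module.finrank_pi_fintype, Finset.sum_const, Finset.card_univ, Fintype.card_coe,
          Int.card_Icc, smul_eq_mul]
        congr 1
        omega

variable (δ) in
/-- The coefficients of an element of the Ore extension. -/
def coeffs : OreLaurent δ ≃ₗ[ℂ] (ℤ →₀ A) := LinearEquiv.refl ℂ (ℤ →₀ A)

theorem coeffs_mono (l : ℤ) (a : A) : coeffs δ (mono δ l a) = Finsupp.single l a := rfl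

theorem eq_sum_mono (x : OreLaurent δ) :
    x = ∑ l ∈ (coeffs δ x).support, mono δ l (coeffs δ x l) :=
  (Finsupp.sum_single (coeffs δ x)).symm

/-- In $(at^m)(bt^l)=\sum_{j<p}\pm\binom mj a\,\delta^j(b)\,t^{m+l-j}$ the coefficients gain one
factor from $T$, and the exponent moves by at most $c+p$. -/
theorem box_mul_mem {T : Set A} (hT : ∀ a ∈ T, δ.toLin a ∈ T) {p c : ℕ}
    (hp : ∀ a ∈ T, ∀ j, p ≤ j → (δ.toLin ^ j) a = 0) {s : OreLaurent δ}
    (hs : ∀ l ∈ (coeffs δ s).support, coeffs δ s l ∈ T ∧ l.natAbs ≤ c) (k K : ℕ)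
    {u : OreLaurent δ} (hu : u ∈ box δ (algGrowthSpan T k) K) :
    u * s ∈ box δ (algGrowthSpan T (k + 1)) (K + (c + p)) := by
  have key : box δ (algGrowthSpan T k) K ≤
      (box δ (algGrowthSpan T (k + 1)) (K + (c + p))).comap (LinearMap.mulRight ℂ s) := by
    refine iSup₂_le fun m hm => ?_
    rintro _ ⟨a, ha, rfl⟩
    rw [Submodule.mem_comap, LinearMap.mulRight_apply, eq_sum_mono s, Finset.mul_sum]
    refine sum_mem fun l hl => ?_
    obtain ⟨hb, hlc⟩ := hs l hl
    rw [mono_mul_mono_eq_sum _ _ _ _ p (fun j hj => by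
      rw [LocNilpDerivation.seq_apply, hp _ hb j hj, mul_zero, smul_zero])]
    refine sum_mem fun j hj => zsmul_mem ?_ _
    rw [Finset.mem_Icc] at hm
    rw [Finset.mem_range] at hj
    exact mono_mem_box (by push_cast; omega) (by push_cast; omega)
      (LocNilpDerivation.seq_mem_algGrowthSpan hT ha ((IsAlgMonomial.of hb).mem_span le_rfl) j)
  exact key hu

theorem algGrowthSpan_le_box {S : Set (OreLaurent δ)} {T : Set A}
    (hT : ∀ a ∈ T, δ.toLin a ∈ T) {p c : ℕ} (hp : ∀ a ∈ T, ∀ j, p ≤ j → (δ.toLin ^ j) a = 0)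
    (hS : ∀ s ∈ S, ∀ l ∈ (coeffs δ s).support, coeffs δ s l ∈ T ∧ l.natAbs ≤ c) (r : ℕ) :
    algGrowthSpan S r ≤ box δ (algGrowthSpan T r) (r * (c + p)) := by
  refine Submodule.span_le.mpr ?_
  rintro x ⟨k, hk, hx⟩
  refine box_mono (algGrowthSpan_mono subset_rfl hk) (Nat.mul_le_mul_right _ hk)
    (hx.mem_of_leftNormed (fun k => box δ (algGrowthSpan T k) (k * (c + p))) ?_ ?_).1
  · intro s hs
    rw [eq_sum_mono s]
    refine sum_mem fun l hl => ?_
    obtain ⟨ha, hb⟩ := hS s hs l hl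
    exact mono_mem_box (by push_cast; omega) (by push_cast; omega)
      ((IsAlgMonomial.of ha).mem_span le_rfl)
  · intro k u hu s hs
    have h := box_mul_mem hT hp (hS s hs) k _ hu
    rwa [← Nat.succ_mul] at h

theorem finrank_algGrowthSpan_le {S : Set (OreLaurent δ)} {T : Set A} (hTf : T.Finite)
    (hT : ∀ a ∈ T, δ.toLin a ∈ T) {p c : ℕ} (hp : ∀ a ∈ T, ∀ j, p ≤ j → (δ.toLin ^ j) a = 0)
    (hS : ∀ s ∈ S, ∀ l ∈ (coeffs δ s).support, coeffs δ s l ∈ T ∧ l.natAbs ≤ c) (r : ℕ)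
    (hr : 1 ≤ r) : Module.finrank ℂ (algGrowthSpan S r) ≤
      (2 * (c + p) + 1) * r * Module.finrank ℂ (algGrowthSpan T r) := by
  have hfin := finiteDimensional_algGrowthSpan hTf r
  have := finiteDimensional_box (δ := δ) (algGrowthSpan T r) (r * (c + p))
  -- The hypothesis $r\ge1$ absorbs the summand 1 into a multiple of $r$.
  have h1 : 2 * (r * (c + p)) + 1 ≤ (2 * (c + p) + 1) * r := by
    rw [add_mul, one_mul, mul_assoc, mul_comm r]
    omega
  exact (Submodule.finrank_mono (algGrowthSpan_le_box hT hp hS r)).trans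
    ((finrank_box_le _ _).trans (Nat.mul_le_mul_right _ h1))

theorem exists_stable_coeffs (S : Finset (OreLaurent δ)) : ∃ (T : Finset A) (p c : ℕ),
    (∀ a ∈ T, δ.toLin a ∈ T) ∧ (∀ a ∈ T, ∀ j, p ≤ j → (δ.toLin ^ j) a = 0) ∧
      ∀ s ∈ S, ∀ l ∈ (coeffs δ s).support, coeffs δ s l ∈ T ∧ l.natAbs ≤ c := by
  classical
  obtain ⟨T, hST, -, hT, p, hp⟩ := δ.exists_stable
    (S.biUnion fun x => (coeffs δ x).support.image (coeffs δ x))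
  refine ⟨T, p, S.sup fun x => (coeffs δ x).support.sup Int.natAbs, hT, hp,
    fun s hs l hl => ⟨hST (Finset.mem_biUnion.mpr ⟨s, hs, Finset.mem_image_of_mem _ hl⟩), ?_⟩⟩
  exact (Finset.le_sup (f := Int.natAbs) hl).trans
    (Finset.le_sup (f := fun x => (coeffs δ x).support.sup Int.natAbs) hs)

theorem growthRate_algGrowthSpan_le (S : Finset (OreLaurent δ)) :
    ∃ T : Finset A,
      growthRate (fun r => Module.finrank ℂ (algGrowthSpan (S : Set (OreLaurent δ)) r)) ≤
        growthRate (fun r => Module.finrank ℂ (algGrowthSpan (T : Set A) r)) + 1 := by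
  obtain ⟨T, p, c, hT, hp, hS⟩ := exists_stable_coeffs S
  have h : ∀ r, 1 ≤ r → Module.finrank ℂ (algGrowthSpan (S : Set (OreLaurent δ)) r) ≤
      (2 * (c + p) + 1) * r * Module.finrank ℂ (algGrowthSpan (T : Set A) r) := fun r hr =>
    finrank_algGrowthSpan_le (S := (S : Set (OreLaurent δ))) (T := (T : Set A)) T.finite_toSet
      hT hp hS r hr
  refine ⟨T, ?_⟩
  exact growthRate_le_add_one (2 * (c + p) + 1) h

theorem algGKDim_le_add_one : algGKDim (OreLaurent δ) ≤ algGKDim A + 1 := by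
  rw [algGKDim_eq_iSup]
  refine iSup_le fun S => ?_
  obtain ⟨T, hT⟩ := growthRate_algGrowthSpan_le S
  refine hT.trans ?_
  gcongr
  exact le_iSup (fun S : Finset A => growthRate fun r =>
    Module.finrank ℂ (algGrowthSpan (S : Set A) r)) T

/-- Since $\delta(1)=0$, multiplying by $t$ on the right only shifts the exponent, at a cost of one
generator. -/
theorem mono_mem_algGrowthSpan {S : Set A} {T : Set (OreLaurent δ)} (hST : mono δ 0 '' S ⊆ T)
    (hT : mono δ 1 1 ∈ T) {r : ℕ} (i : ℕ) {a : A} (ha : a ∈ algGrowthSpan S r) :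
    mono δ i a ∈ algGrowthSpan T (r + i) := by
  induction i with
  | zero =>
    induction ha using Submodule.span_induction with
    | zero => simp
    | add x₁ x₂ _ _ h₁ h₂ => rw [map_add]; exact add_mem h₁ h₂
    | smul c x _ h => rw [map_smul]; exact Submodule.smul_mem _ _ h
    | mem x hx =>
      obtain ⟨k, hk, hx⟩ := hx
      exact ((hx.map (mono δ 0) fun x y => (mono_zero_mul_mono_zero x y).symm).mono hST).mem_span hk
  | succ i ih =>
    have h2 := mul_mem_algGrowthSpan ih ((IsAlgMonomial.of hT).mem_span le_rfl)
    rw [mono_mul_mono_one] at h2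
    exact_mod_cast h2

/-- The sums $\sum_{i<r}v_it^i$ with $v_i$ of length at most $r$ have length at most $2r$, and
distinct powers of $t$ are independent over $A$. -/
theorem mul_finrank_le {S : Set A} {T : Set (OreLaurent δ)} (hS : S.Finite) (hTf : T.Finite)
    (hST : mono δ 0 '' S ⊆ T) (hT : mono δ 1 1 ∈ T) (r : ℕ) :
    r * Module.finrank ℂ (algGrowthSpan S r) ≤ Module.finrank ℂ (algGrowthSpan T (2 * r)) := by
  have := finiteDimensional_algGrowthSpan hS r
  have := finiteDimensional_algGrowthSpan hTf (2 * r)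
  let f : (Fin r → algGrowthSpan S r) →ₗ[ℂ] OreLaurent δ :=
    ∑ i : Fin r, mono δ (i : ℕ) ∘ₗ (algGrowthSpan S r).subtype ∘ₗ LinearMap.proj i
  have hf : ∀ v, f v = ∑ i : Fin r, mono δ (i : ℕ) (v i).1 := fun v => by
    simp only [f, LinearMap.sum_apply]
    rfl
  have hmem : ∀ v, f v ∈ algGrowthSpan T (2 * r) := fun v => by
    rw [hf]
    exact sum_mem fun i _ => algGrowthSpan_mono subset_rfl (by omega)
      (mono_mem_algGrowthSpan hST hT i (v i).2)
  have hinj : Function.Injective (f.codRestrict _ hmem) := by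
    refine (injective_iff_map_eq_zero _).mpr fun v hv => ?_
    have hv : f v = 0 := congrArg Subtype.val hv
    funext i
    have h2 := congrArg (fun x => coeffs δ x (i : ℕ)) hv
    simp only [hf, map_sum, coeffs_mono, map_zero] at h2
    rw [Finsupp.finsetSum_apply, Finset.sum_eq_single i] at h2
    · exact Subtype.ext (by simpa using h2)
    · intro j _ hj
      refine Finsupp.single_eq_of_ne fun h4 => hj (Fin.ext (by omega))
    · simp
  have h2 := LinearMap.finrank_le_finrank_of_injective hinj
  rwa [Module.finrank_pi_fintype, Finset.sum_const, Finset.card_univ, Fintype.card_fin,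
    smul_eq_mul] at h2

theorem growthRate_add_one_le_algGKDim [Nontrivial A] (S : Finset A) :
    growthRate (fun r => Module.finrank ℂ (algGrowthSpan (S : Set A) r)) + 1 ≤
      algGKDim (OreLaurent δ) := by
  classical
  -- Adjoining 1 makes all growth dimensions positive, as `growthRate_add_one_le` requires.
  set S' : Finset A := insert 1 S with hS'
  set T : Finset (OreLaurent δ) := insert (mono δ 1 1) (S'.image (mono δ 0)) with hT
  have h1 : growthRate (fun r => Module.finrank ℂ (algGrowthSpan (S : Set A) r)) ≤
      growthRate (fun r => Module.finrank ℂ (algGrowthSpan (S' : Set A) r)) :=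
    growthRate_mono fun r => finrank_algGrowthSpan_mono S'.finite_toSet (by simp [hS']) r
  have h2 : growthRate (fun r => Module.finrank ℂ (algGrowthSpan (S' : Set A) r)) + 1 ≤
      growthRate (fun r => Module.finrank ℂ (algGrowthSpan (T : Set (OreLaurent δ)) r)) := by
    refine growthRate_add_one_le (fun r hr => ?_) fun r =>
      mul_finrank_le S'.finite_toSet T.finite_toSet (by simp [hT]) (by simp [hT]) r
    have := finiteDimensional_algGrowthSpan S'.finite_toSet r
    rw [Nat.one_le_iff_ne_zero, Ne, Submodule.finrank_eq_zero]
    intro h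
    have h1 : (1 : A) ∈ algGrowthSpan (S' : Set A) r :=
      (IsAlgMonomial.of (by simp [hS'])).mem_span hr
    rw [h] at h1
    exact one_ne_zero ((Submodule.mem_bot ℂ).mp h1)
  have h3 : growthRate (fun r => Module.finrank ℂ (algGrowthSpan (S : Set A) r)) + 1 ≤
      growthRate (fun r => Module.finrank ℂ (algGrowthSpan (S' : Set A) r)) + 1 := by
    gcongr
  rw [algGKDim_eq_iSup]
  exact (h3.trans h2).trans (le_iSup (fun S : Finset (OreLaurent δ) => growthRate fun r =>
    Module.finrank ℂ (algGrowthSpan (S : Set (OreLaurent δ)) r)) T)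

theorem add_one_le_algGKDim [Nontrivial A] : algGKDim A + 1 ≤ algGKDim (OreLaurent δ) := by
  have h1 : ((1 : ℝ) : EReal) = 1 := rfl
  rw [algGKDim_eq_iSup A, ← h1]
  -- The finite summand 1 is moved to the right so that the supremum can be bounded termwise, then
  -- moved back.
  refine EReal.add_le_of_le_sub (iSup_le fun S => ?_)
  refine (EReal.le_sub_iff_add_le (Or.inl (EReal.coe_ne_bot 1)) (Or.inl (EReal.coe_ne_top 1))).mpr ?_
  rw [h1]
  exact growthRate_add_one_le_algGKDim S

theorem algGKDim_eq_add_one [Nontrivial A] : algGKDim (OreLaurent δ) = algGKDim A + 1 :=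
  le_antisymm algGKDim_le_add_one add_one_le_algGKDim

end OreLaurent

end OreGrowth

end

noncomputable section

/-! ### Growth and finite generation of $C$ in terms of $A$ -/

section ConformalGrowth

open ConformalAlgebra

variable {C : Type u} [AddCommGroup C] [Module ℂ C] [Module ℂ[X] C]
    [IsScalarTower ℂ ℂ[X] C] [ConformalAlgebra C] {A : Type u} [Ring A] [Algebra ℂ A]
    {δ : LocNilpDerivation A}

namespace ConformalAlgebra

variable (C) in
theorem gkDim_eq_iSup : gkDim C =
    ⨆ S : Finset C, growthRate fun r => Module.finrank ℂ[X] (growthSpan (S : Set C) r) := rfl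

/-- A complex subspace stable under `∂` is closed under the action of `ℂ[∂]`. -/
theorem smul_mem_of_X_smul_mem (Q : Submodule ℂ C) (hQ : ∀ x ∈ Q, (X : ℂ[X]) • x ∈ Q) (p : ℂ[X])
    {x : C} (hx : x ∈ Q) : p • x ∈ Q := by
  induction p using Polynomial.induction_on' with
  | add p q hp hq => rw [add_smul]; exact add_mem hp hq
  | monomial j c =>
    rw [← C_mul_X_pow_eq_monomial, ← smul_eq_C_mul, smul_assoc]
    refine Q.smul_mem c ?_
    induction j with
    | zero => simpa
    | succ j ih => rw [pow_succ', mul_smul]; exact hQ _ ih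

/-- Products may be checked on $\mathbb C[\partial]$-generators. All orders $n$ are needed at once
because $\partial$ on the left lowers the order. -/
theorem nprod_mem_of_mem_span {U V : Set C} {Q : Submodule ℂ[X] C}
    (h : ∀ n, ∀ u ∈ U, ∀ v ∈ V, nprod n u v ∈ Q) (n : ℕ) {x y : C}
    (hx : x ∈ Submodule.span ℂ[X] U) (hy : y ∈ Submodule.span ℂ[X] V) : nprod n x y ∈ Q := by
  have hsmul : ∀ (c : ℂ) (z : C), z ∈ Q → c • z ∈ Q := fun c z hz => by
    rw [← one_smul ℂ[X] z, ← smul_assoc]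
    exact Q.smul_mem _ hz
  have h1 : ∀ v ∈ V, ∀ x ∈ Submodule.span ℂ[X] U, ∀ n, nprod n x v ∈ Q := by
    intro v hv x hx
    induction hx using Submodule.span_induction with
    | mem x hx => exact fun n => h n x hx v hv
    | zero => simp
    | add x₁ x₂ _ _ h₁ h₂ => intro n; rw [map_add]; exact add_mem (h₁ n) (h₂ n)
    | smul p x _ hx =>
      refine smul_mem_of_X_smul_mem
        { carrier := {x | ∀ n, nprod n x v ∈ Q}
          add_mem' := fun h₁ h₂ n => by rw [map_add]; exact add_mem (h₁ n) (h₂ n)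
          zero_mem' := by simp
          smul_mem' := fun c x hx n => by
            rw [map_smul]; exact hsmul c _ (hx n) } (fun x hx n => ?_) p hx
      rw [sesqui]
      exact hsmul _ _ (hx _)
  have h2 : ∀ y ∈ Submodule.span ℂ[X] V, ∀ x ∈ Submodule.span ℂ[X] U, ∀ n, nprod n x y ∈ Q := by
    intro y hy
    induction hy using Submodule.span_induction with
    | mem y hy => exact h1 y hy
    | zero => simp
    | add x₁ x₂ _ _ h₁ h₂ => intro x hx n; rw [map_add]; exact add_mem (h₁ x hx n) (h₂ x hx n)
    | smul p y _ hy =>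
      refine smul_mem_of_X_smul_mem
        { carrier := {y | ∀ x ∈ Submodule.span ℂ[X] U, ∀ n, nprod n x y ∈ Q}
          add_mem' := fun h₁ h₂ x hx n => by rw [map_add]; exact add_mem (h₁ x hx n) (h₂ x hx n)
          zero_mem' := by simp
          smul_mem' := fun c y hy x hx n => by
            rw [map_smul]; exact hsmul c _ (hy x hx n) } (fun y hy x hx n => ?_) p hy
      -- Here $x_{(n)}\partial y=\partial(x_{(n)}y)-(\partial x)_{(n)}y$, which is why the claim is
      -- made for all $x$ in the span, not only for $x\in U$.
      have h3 := leibniz n x y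
      rw [← sub_eq_iff_eq_add'] at h3
      rw [← h3]
      exact sub_mem (Q.smul_mem _ (hy x hx n)) (hy _ (Submodule.smul_mem _ _ hx) n)
  exact h2 y hy x hx n

end ConformalAlgebra

namespace DiffModel

variable (M : DiffModel C δ)

/-- The `ℂ[∂]`-submodule `ℂ[∂] ⊗ V` of `C`. -/
def extend (V : Submodule ℂ A) : Submodule ℂ[X] C := Submodule.span ℂ[X] (M.incl '' V)

theorem mem_extend_of_coord_mem {V : Submodule ℂ A} {x : C} (hx : ∀ k, M.coord k x ∈ V) :
    x ∈ M.extend V := by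
  obtain ⟨N, hN⟩ := M.exists_sum x
  rw [hN]
  exact sum_mem fun k _ => Submodule.smul_mem _ _ (Submodule.subset_span ⟨_, hx k, rfl⟩)

theorem coord_mem_of_mem_extend {V : Submodule ℂ A} {x : C} (hx : x ∈ M.extend V) (k : ℕ) :
    M.coord k x ∈ V := by
  obtain ⟨n, f, g, rfl⟩ := Submodule.mem_span_set'.mp hx
  rw [map_sum]
  refine sum_mem fun i _ => ?_
  obtain ⟨a, ha, h⟩ := (g i).2
  rw [← h, M.coord_smul]
  exact V.smul_mem _ ha

theorem mem_of_incl_mem_extend {V : Submodule ℂ A} {a : A} (ha : M.incl a ∈ M.extend V) :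
    a ∈ V := by
  rw [← M.coord_incl a]
  exact M.coord_mem_of_mem_extend ha 0

theorem extend_mono {V W : Submodule ℂ A} (h : V ≤ W) : M.extend V ≤ M.extend W :=
  Submodule.span_mono (Set.image_mono h)

/-- Comparing the coefficients of $\partial^k$ in a relation gives a relation over $\mathbb C$ for
each $k$. This makes the rank of $\mathbb C[\partial]\otimes V$ equal to $\dim V$. -/
theorem linearIndependent_incl {ι : Type*} {v : ι → A} (hv : LinearIndependent ℂ v) :
    LinearIndependent ℂ[X] fun i => M.incl (v i) := by
  rw [linearIndependent_iff'] at hv ⊢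
  intro s g hg i hi
  ext k
  refine hv s (fun i => (g i).coeff k) ?_ i hi
  have h := congrArg (M.coord k) hg
  simpa [M.coord_smul] using h

theorem extend_eq_span (V : Submodule ℂ A) {ι : Type*} (b : Module.Basis ι ℂ V) :
    M.extend V = Submodule.span ℂ[X] (Set.range fun i => M.incl (b i)) := by
  refine le_antisymm (Submodule.span_le.mpr ?_) (Submodule.span_mono ?_)
  · rintro _ ⟨a, ha, rfl⟩
    have h : a ∈ Submodule.span ℂ (Set.range fun i => (b i : A)) := by
      have h2 := b.mem_span ⟨a, ha⟩
      have h3 := Submodule.mem_map_of_mem (f := V.subtype) h2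
      rw [Submodule.map_span, ← Set.range_comp] at h3
      exact h3
    have h4 := Submodule.mem_map_of_mem (f := M.incl) h
    rw [Submodule.map_span, ← Set.range_comp] at h4
    exact Submodule.span_le_restrictScalars ℂ ℂ[X] _ h4
  · rintro _ ⟨i, rfl⟩
    exact ⟨b i, (b i).2, rfl⟩

theorem finite_extend (V : Submodule ℂ A) [FiniteDimensional ℂ V] :
    Module.Finite ℂ[X] (M.extend V) := by
  rw [M.extend_eq_span V (Module.finBasis ℂ V)]
  exact Module.Finite.span_of_finite _ (Set.finite_range _)

theorem finrank_extend (V : Submodule ℂ A) [FiniteDimensional ℂ V] :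
    Module.finrank ℂ[X] (M.extend V) = Module.finrank ℂ V := by
  have hli : LinearIndependent ℂ fun i => (Module.finBasis ℂ V i : A) :=
    (Module.finBasis ℂ V).linearIndependent.map' V.subtype (Submodule.ker_subtype V)
  rw [M.extend_eq_span V (Module.finBasis ℂ V), finrank_span_eq_card (M.linearIndependent_incl hli),
    Fintype.card_fin]

theorem growthSpan_le_extend {S : Set C} {T : Set A} (hT : ∀ a ∈ T, δ.toLin a ∈ T)
    (hS : ∀ s ∈ S, ∀ k, M.coord k s ∈ T) (r : ℕ) :
    growthSpan S r ≤ M.extend (algGrowthSpan T r) := by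
  refine Submodule.span_le.mpr ?_
  rintro x ⟨k, hk, hx⟩
  refine M.extend_mono (algGrowthSpan_mono subset_rfl hk) ?_
  clear hk
  induction hx with
  | of ha =>
    exact M.mem_extend_of_coord_mem fun k => (IsAlgMonomial.of (hS _ ha k)).mem_span le_rfl
  | prod n _ _ iha ihb =>
    refine nprod_mem_of_mem_span ?_ n iha ihb
    rintro n _ ⟨a, ha, rfl⟩ _ ⟨b, hb, rfl⟩
    rw [M.nprod_incl]
    exact Submodule.subset_span ⟨_, LocNilpDerivation.seq_mem_algGrowthSpan hT ha hb n, rfl⟩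

theorem extend_le_growthSpan (S : Set A) (r : ℕ) :
    M.extend (algGrowthSpan S r) ≤ growthSpan (M.incl '' S) r := by
  have key : ∀ {k : ℕ} {x : A}, IsAlgMonomial S k x →
      IsMonomial (M.incl '' S) k (M.incl x) := by
    intro k x hx
    induction hx with
    | of ha => exact .of ⟨_, ha, rfl⟩
    | @mul p q a b _ _ iha ihb =>
      have h : M.incl (a * b) = nprod 0 (M.incl a) (M.incl b) := by
        rw [M.nprod_incl, LocNilpDerivation.seq_apply]
        simp
      rw [h]
      exact .prod 0 iha ihb
  refine Submodule.span_le.mpr ?_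
  rintro _ ⟨a, ha, rfl⟩
  have h4 := Submodule.mem_map_of_mem (f := M.incl) ha
  rw [algGrowthSpan, Submodule.map_span] at h4
  refine Submodule.span_mono ?_ (Submodule.span_le_restrictScalars ℂ ℂ[X] _ h4)
  rintro _ ⟨x, ⟨k, hk, hx⟩, rfl⟩
  exact ⟨k, hk, key hx⟩

/-- The coordinates of the elements of a finite set lie in a `δ`-stable finite set. -/
theorem exists_stable_coord (M : DiffModel C δ) (S : Finset C) : ∃ T : Finset A,
    (∀ a ∈ T, δ.toLin a ∈ T) ∧ ∀ s ∈ S, ∀ k, M.coord k s ∈ T := by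
  classical
  choose N hN using M.exists_sum
  obtain ⟨T, hST, h0, hT, -⟩ := δ.exists_stable
    (S.biUnion fun s => (Finset.range (N s)).image fun k => M.coord k s)
  refine ⟨T, hT, fun s hs k => ?_⟩
  rcases lt_or_ge k (N s) with h | h
  · exact hST (Finset.mem_biUnion.mpr ⟨s, hs, Finset.mem_image.mpr ⟨k, by simpa using h, rfl⟩⟩)
  -- Coordinates beyond the length of the expansion vanish, and $0\in T$.
  · rw [hN s, map_sum, Finset.sum_eq_zero]
    · exact h0
    · intro j hj
      rw [M.coord_smul, coeff_X_pow, if_neg, zero_smul]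
      have := Finset.mem_range.mp hj
      omega

theorem finite_growthSpan (M : DiffModel C δ) (S : Finset C) (r : ℕ) :
    Module.Finite ℂ[X] (growthSpan (S : Set C) r) := by
  obtain ⟨T, hT, hS⟩ := M.exists_stable_coord S
  have := finiteDimensional_algGrowthSpan T.finite_toSet r
  have := M.finite_extend (algGrowthSpan (T : Set A) r)
  exact Module.Finite.of_injective _
    (Submodule.inclusion_injective (M.growthSpan_le_extend (T := T) hT hS r))

theorem algGKDim_eq_gkDim (M : DiffModel C δ) : algGKDim A = gkDim C := by
  classical
  rw [algGKDim_eq_iSup, gkDim_eq_iSup]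
  refine le_antisymm (iSup_le fun S => ?_) (iSup_le fun S => ?_)
  · refine le_iSup_of_le (S.image M.incl) (growthRate_mono fun r => ?_)
    have := finiteDimensional_algGrowthSpan S.finite_toSet r
    have := M.finite_growthSpan (S.image M.incl) r
    rw [← M.finrank_extend]
    refine Submodule.finrank_mono ?_
    rw [Finset.coe_image]
    exact M.extend_le_growthSpan S r
  · obtain ⟨T, hT, hS⟩ := M.exists_stable_coord S
    refine le_iSup_of_le T (growthRate_mono fun r => ?_)
    have := finiteDimensional_algGrowthSpan T.finite_toSet r
    have := M.finite_extend (algGrowthSpan (T : Set A) r)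
    rw [← M.finrank_extend]
    exact Submodule.finrank_mono (M.growthSpan_le_extend (T := T) hT hS r)

theorem finiteType_of_isFinitelyGenerated (M : DiffModel C δ) (h : IsFinitelyGenerated C) : Algebra.FiniteType ℂ A := by
  obtain ⟨S, hS⟩ := h
  obtain ⟨T, hT, hST⟩ := M.exists_stable_coord S
  refine ⟨T, ?_⟩
  set B := Algebra.adjoin ℂ (T : Set A) with hB
  -- Stability of $B$ under $\delta$ makes $\mathbb C[\partial]\otimes B$ closed under all products;
  -- as it contains the generators, it is $C$, whence $B=A$.
  have hδ : ∀ a ∈ B, δ.toLin a ∈ B := by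
    intro a ha
    induction ha using Algebra.adjoin_induction with
    | mem a ha => exact Algebra.subset_adjoin (hT a ha)
    | algebraMap c =>
      rw [Algebra.algebraMap_eq_smul_one, map_smul, OreLaurent.map_one_eq_zero, smul_zero]
      exact zero_mem _
    | add a b _ _ iha ihb => rw [map_add]; exact add_mem iha ihb
    | mul a b ha hb iha ihb =>
      rw [δ.leibniz]
      exact add_mem (mul_mem iha hb) (mul_mem ha ihb)
  have hδn : ∀ n, ∀ a ∈ B, (δ.toLin ^ n) a ∈ B := fun n a ha =>
    LocNilpDerivation.pow_mem_of_stable (T := (B : Set A)) hδ n ha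
  have htop := hS (M.extend (Subalgebra.toSubmodule B))
    (fun s hs => M.mem_extend_of_coord_mem fun k => Algebra.subset_adjoin (hST s hs k))
    (fun n a b ha hb => nprod_mem_of_mem_span (by
      rintro n _ ⟨a, ha, rfl⟩ _ ⟨b, hb, rfl⟩
      rw [M.nprod_incl, LocNilpDerivation.seq_apply]
      exact Submodule.subset_span ⟨_, B.smul_mem (mul_mem ha (hδn n b hb)) _, rfl⟩) n ha hb)
  refine eq_top_iff.mpr fun a _ => M.mem_of_incl_mem_extend (V := Subalgebra.toSubmodule B) ?_
  rw [htop]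
  trivial

end DiffModel

end ConformalGrowth

end

/-! ### The main theorem -/

theorem proposition3p5 {C : Type u} [AddCommGroup C] [Module ℂ C] [Module ℂ[X] C]
    [IsScalarTower ℂ ℂ[X] C] [ConformalAlgebra C] [ConformalAlgebra.IsAssociative C]
    (e : C) (he : ConformalAlgebra.IsConformalIdentity e)
    (hL : ConformalAlgebra.leftAnnihilator C = {0}) :
    algGKDim (ConformalAlgebra.Coeff C) = ConformalAlgebra.gkDim C + 1 ∧
    ∃ (A : Type u) (_ : Ring A) (_ : Algebra ℂ A) (δ : LocNilpDerivation A),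
      (∃ φ : ConformalAlgebra.Coeff C →ₙₐ[ℂ] OreLaurent δ, Function.Bijective φ) ∧
      algGKDim A = ConformalAlgebra.gkDim C ∧
      (ConformalAlgebra.IsFinitelyGenerated C → Algebra.FiniteType ℂ A) := by
  let M := ConformalAlgebra.Core.diffModel he hL
  refine ⟨?_, _, _, _, _, ⟨M.coeffHom, M.coeffEquiv.bijective⟩, M.algGKDim_eq_gkDim,
    M.finiteType_of_isFinitelyGenerated⟩
  rw [← M.algGKDim_eq_gkDim, ← OreLaurent.algGKDim_eq_add_one (δ := ConformalAlgebra.Core.deriv he hL)]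
  exact algGKDim_eq_of_equiv M.coeffEquiv M.coeffEquiv_mul
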